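/- Let $m,d\ge 1$ be integers, equip $\mathbb{R}^m$ and $\mathbb{R}^d$ with the Euclidean metric, let $\lambda^m$ denote Lebesgue measure on $\mathbb{R}^m$, and let $C([0,1]^m,\mathbb{R}^d)$ be the Banach space of continuous maps $f\colon[0,1]^m\to\mathbb{R}^d$ with the topology of uniform convergence. A subset $A$ of an abelian Polish group $G$ is called shy (Haar null) if there are a Borel set $B\supseteq A$ and a Borel probability measure $\mu$ on $G$ such that $\mu(B+x)=0$ for all $x\in G$; a set is prevalent if its complement is shy. Then the set of all $f\in C([0,1]^m,\mathbb{R}^d)$ with the following property is prevalent in $C([0,1]^m,\mathbb{R}^d)$: there is an open set $U_f\subseteq\mathbb{R}^d$ such that 1. $\lambda^m\bigl(f^{-1}(U_f)\bigr)=1$, 2. $U_f$ is dense in $f([0,1]^m)$, that is, $f([0,1]^m)\subseteq\overline{U_f\cap f([0,1]^m)}$, and 3. $\dim_H f^{-1}(y)=m$ for all $y\in U_f$, where $\dim_H$ denotes Hausdorff dimension. -/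

import Mathlib

open MeasureTheory

/-- A subset `A` of an abelian Polish group `G` is *shy* (Haar null) if there are a Borel set `B`
containing `A` and a Borel probability measure `μ` on `G` with `μ (B + x) = 0` for all `x`. -/
def IsShy {G : Type*} [AddCommGroup G] [TopologicalSpace G] [IsTopologicalAddGroup G]
    [PolishSpace G] [MeasurableSpace G] [BorelSpace G] (A : Set G) : Prop :=
  ∃ (B : Set G) (μ : Measure G), MeasurableSet B ∧ IsProbabilityMeasure μ ∧ A ⊆ B ∧
    ∀ x : G, μ ((fun b => b + x) '' B) = 0

/-- A set is *prevalent* if its complement is shy. -/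
def IsPrevalent {G : Type*} [AddCommGroup G] [TopologicalSpace G] [IsTopologicalAddGroup G]
    [PolishSpace G] [MeasurableSpace G] [BorelSpace G] (A : Set G) : Prop :=
  IsShy Aᶜ

/-- The cube `[0,1]^m` as a subset of Euclidean space `ℝ^m`. -/
def unitCube (m : ℕ) : Set (EuclideanSpace ℝ (Fin m)) :=
  {x | ∀ i, x i ∈ Set.Icc (0 : ℝ) 1}

theorem isCompact_unitCube (m : ℕ) : IsCompact (unitCube m) := by
  have h : IsCompact (Set.pi Set.univ fun _ : Fin m => Set.Icc (0 : ℝ) 1) :=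
    isCompact_univ_pi fun _ => isCompact_Icc
  have h2 := (EuclideanSpace.equiv (Fin m) ℝ).toHomeomorph.isCompact_preimage.2 h
  convert h2 using 1
  ext x
  change (∀ i, x i ∈ Set.Icc (0 : ℝ) 1) ↔ ∀ i ∈ Set.univ, x i ∈ Set.Icc (0 : ℝ) 1
  simp

instance instCompactSpaceUnitCube (m : ℕ) : CompactSpace (unitCube m) :=
  isCompact_iff_compactSpace.1 (isCompact_unitCube m)

/-!
There is a random map `Φ` such that for every fixed continuous `g` the map `g + Φ` almost surely has
the required property; the law of `Φ` is the measure that witnesses prevalence.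

**The random map.** The cube carries nested grids of `2 ^ 4 ^ n` cells per side, and
`Φ = ∑ 4⁻ⁿ φₙ`, where `φₙ` is constant on the core of each cell of level `n + 1`, with an
independent random value (`labelVec`) in `{-8, …, 7} ^ d`. The cells shrink so fast that each cell
has enormously many children compared with the number of scales seen so far.

**Hits.** Nothing is known about the modulus of continuity of `g`, so it is not true that `g` is
nearly constant on small cells. What helps is that `g` is bounded: at precision `4⁻ⁿ` it takes only
about `4 ^ (d n)` values, so on a cell `I` of level `n` most of the mass of `I` lies in level pieces
`{quantize n ∘ g = q}` of relative mass at least `8 ^ (-d n)`. Removing recursively all smaller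
pieces (`exists_pruned_set`, `exists_isPruned`) leaves a set `S` of measure close to `1`, all of
whose pieces are large in this sense. Each such piece meets a fraction `8 ^ (-d n)` of the children
of `I`, and by a Chernoff bound and the Borel–Cantelli lemma almost surely, from some level on,
every label occurs on a proportional number of these children (`IsPruned.ae_exists_hasHits`).

**Fibers.** Given a target `y` near `g x + Φ x`, one can therefore correct the residual by choosing
children with the right label, at all later levels (`HasHits.exists_children`). The finite trees of
approximate preimages obtained in this way are so bushy that the mass distribution principle gives
Hausdorff content bounded below in every dimension `s < m`
(`exists_card_le_mul_rpow`, `hasContentGE_of_finsets`). The bound is uniform over a ball of targets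
around `g x + Φ x` as soon as one late layer vanishes at `x`, which happens for almost every `x`
(`ae_ae_frequently_label_eq`, `mem_bigFiberTargets_of_hasHits`).

**Measurability.** For a fixed set `V` of targets, a lower bound on the content with respect to open
covers of all fibers over `V` is a closed condition on the map (`isClosed_setOf_hasContentGE`).
Hence the maps sending almost every point into an open set of targets with such bounds form a Borel
set, `goodMaps`. Full measure implies density because nonempty open subsets of the cube have
positive measure.
-/

open Set Filter Topology ProbabilityTheory
open scoped ENNReal NNReal

/-! ### Pruning a finite measure space -/

/-- Removing recursively from `X₀` every piece `E i` whose remaining part has measure less than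
`τ i` costs at most `∑ τ i`, since each piece is removed only once; what is left meets
every `E i` in the empty set or in measure at least `τ i`. -/
lemma exists_pruned_set {X ι : Type*} [MeasurableSpace X] [Countable ι] (μ : Measure X)
    [IsFiniteMeasure μ] {X₀ : Set X} (hX₀ : MeasurableSet X₀) {E : ι → Set X}
    (hE : ∀ i, MeasurableSet (E i)) (τ : ι → ℝ≥0∞) :
    ∃ S ⊆ X₀, MeasurableSet S ∧ μ (X₀ \ S) ≤ ∑' i, τ i ∧
      ∀ i, (S ∩ E i).Nonempty → τ i ≤ μ (S ∩ E i) := by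
  classical
  let next : Set X → Set X := fun A => A \ ⋃ i ∈ {i | μ (A ∩ E i) < τ i}, E i
  let A : ℕ → Set X := fun k => next^[k] X₀
  have hA0 : A 0 = X₀ := rfl
  have hAs : ∀ k, A (k + 1) = A k \ ⋃ i ∈ {i | μ (A k ∩ E i) < τ i}, E i := fun k => by
    simp only [A, Function.iterate_succ_apply', next]
  have hAm : ∀ k, MeasurableSet (A k) := by
    intro k
    induction k with
    | zero => exact hX₀
    | succ k ih =>
      rw [hAs]
      exact ih.diff (MeasurableSet.biUnion (to_countable _) fun i _ => hE i)
  have hanti : Antitone A := antitone_nat_of_succ_le fun k => by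
    rw [hAs]; exact sdiff_subset
  refine ⟨⋂ k, A k, iInter_subset A 0, MeasurableSet.iInter hAm, ?_, ?_⟩
  · -- Each `E i` is removed at the first stage at which its remaining part is too small.
    let first : ι → Set X := fun i =>
      if h : ∃ k, μ (A k ∩ E i) < τ i then A (Nat.find h) ∩ E i else ∅
    have hfirst : ∀ i, μ (first i) ≤ τ i := by
      intro i
      by_cases h : ∃ k, μ (A k ∩ E i) < τ i
      · simp only [first, dif_pos h]; exact (Nat.find_spec h).le
      · simp [first, dif_neg h]
    have hsub : X₀ \ ⋂ k, A k ⊆ ⋃ i, first i := by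
      rintro x ⟨hx0, hx⟩
      have hex : ∃ k, x ∉ A k := by simpa using hx
      obtain ⟨k, hk⟩ : ∃ k, Nat.find hex = k + 1 :=
        Nat.exists_eq_succ_of_ne_zero fun h0 => Nat.find_spec hex (by rw [h0]; exact hx0)
      have hxk : x ∈ A k := by
        by_contra hc
        have := Nat.find_min' hex hc
        omega
      have hxk' : x ∉ A (k + 1) := hk ▸ Nat.find_spec hex
      rw [hAs] at hxk'
      have : ∃ i, μ (A k ∩ E i) < τ i ∧ x ∈ E i := by
        by_contra hc
        push Not at hc
        exact hxk' ⟨hxk, by simpa using fun i hi => hc i hi⟩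
      obtain ⟨i, hi, hxi⟩ := this
      have h : ∃ k, μ (A k ∩ E i) < τ i := ⟨k, hi⟩
      refine mem_iUnion.2 ⟨i, ?_⟩
      simp only [first, dif_pos h]
      exact ⟨hanti (Nat.find_min' h hi) hxk, hxi⟩
    calc μ (X₀ \ ⋂ k, A k) ≤ μ (⋃ i, first i) := measure_mono hsub
      _ ≤ ∑' i, μ (first i) := measure_iUnion_le _
      _ ≤ ∑' i, τ i := ENNReal.tsum_le_tsum hfirst
  · rintro i ⟨x, hxS, hxi⟩
    have hge : ∀ k, τ i ≤ μ (A k ∩ E i) := by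
      intro k
      by_contra hc
      have hx : x ∈ A (k + 1) := mem_iInter.1 hxS _
      rw [hAs] at hx
      exact hx.2 (mem_biUnion (show i ∈ {i | μ (A k ∩ E i) < τ i} from not_le.1 hc) hxi)
    have hlim : Tendsto (fun k => μ (A k ∩ E i)) atTop (𝓝 (μ (⋂ k, (A k ∩ E i)))) :=
      tendsto_measure_iInter_atTop (fun k => ((hAm k).inter (hE i)).nullMeasurableSet)
        (fun a b hab => inter_subset_inter_left _ (hanti hab)) ⟨0, measure_ne_top _ _⟩
    rw [iInter_inter]
    exact ge_of_tendsto' hlim hge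

/-! ### Finite trees of points -/

/-- If every point with property `Q n` has `L n` descendants with property `Q (n + 1)` in distinct
children of its cell, then iterating yields finite sets of points with property `Q (k + N)` that are
spread evenly over the cells of all intermediate levels. -/
lemma exists_finset_tree {X κ : Type*} [DecidableEq κ] {c : ℕ → X → κ}
    (hc : ∀ n x y, c (n + 1) x = c (n + 1) y → c n x = c n y) {Q : ℕ → X → Prop} {L : ℕ → ℕ}
    {n₁ : ℕ}
    (hQ : ∀ n, n₁ ≤ n → ∀ x, Q n x → ∃ P : Finset X, P.card = L n ∧
      (∀ p ∈ P, Q (n + 1) p ∧ c n p = c n x) ∧ Set.InjOn (c (n + 1)) P)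
    (N : ℕ) : ∀ k, n₁ ≤ k → ∀ x, Q k x → ∃ P : Finset X,
      (∀ p ∈ P, Q (k + N) p ∧ c k p = c k x) ∧ P.card = ∏ j ∈ Finset.Ico k (k + N), L j ∧
      ∀ l, k ≤ l → l ≤ k + N → ∀ J,
        (P.filter fun p => c l p = J).card ≤ ∏ j ∈ Finset.Ico l (k + N), L j := by
  classical
  have hmono : ∀ l k, k ≤ l → ∀ x y, c l x = c l y → c k x = c k y := by
    intro l k hkl
    induction l, hkl using Nat.le_induction with
    | base => exact fun _ _ h => h
    | succ l _ ih => exact fun x y h => ih x y (hc l x y h)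
  induction N with
  | zero =>
    intro k _ x hx
    refine ⟨{x}, ?_, by simp, ?_⟩
    · simpa using hx
    · intro l hl hl' J
      obtain rfl : l = k := by omega
      simpa using Finset.card_filter_le ({x} : Finset X) (fun p => c l p = J)
  | succ N ih =>
    intro k hk x hx
    obtain ⟨P₀, hcard, hP₀, hinj⟩ := hQ k hk x hx
    have hex : ∀ p : X, ∃ P : Finset X, p ∈ P₀ →
        ((∀ z ∈ P, Q (k + 1 + N) z ∧ c (k + 1) z = c (k + 1) p) ∧
        P.card = ∏ j ∈ Finset.Ico (k + 1) (k + 1 + N), L j ∧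
        ∀ l, k + 1 ≤ l → l ≤ k + 1 + N → ∀ J,
          (P.filter fun p => c l p = J).card ≤ ∏ j ∈ Finset.Ico l (k + 1 + N), L j) := by
      intro p
      by_cases hp : p ∈ P₀
      · obtain ⟨P, hP⟩ := ih (k + 1) (by omega) p (hP₀ p hp).1
        exact ⟨P, fun _ => hP⟩
      · exact ⟨∅, fun h => absurd h hp⟩
    choose T hT using hex
    have hdisj : Set.PairwiseDisjoint (P₀ : Set X) T := by
      intro p hp p' hp' hne
      refine Finset.disjoint_left.2 fun z hz hz' => hne (hinj hp hp' ?_)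
      rw [← ((hT p hp).1 z hz).2, ((hT p' hp').1 z hz').2]
    have hkN : k + (N + 1) = k + 1 + N := by omega
    rw [hkN]
    have hcardU : (P₀.biUnion T).card = ∏ j ∈ Finset.Ico k (k + 1 + N), L j := by
      rw [Finset.card_biUnion hdisj, Finset.sum_congr rfl fun p hp => (hT p hp).2.1,
        Finset.sum_const, smul_eq_mul, hcard,
        Finset.prod_eq_prod_Ico_succ_bot (show k < k + 1 + N by omega)]
    refine ⟨P₀.biUnion T, ?_, hcardU, ?_⟩
    · intro z hz
      obtain ⟨p, hp, hz⟩ := Finset.mem_biUnion.1 hz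
      have h := (hT p hp).1 z hz
      exact ⟨h.1, (hc _ _ _ h.2).trans (hP₀ p hp).2⟩
    · intro l hl hl' J
      rcases hl.eq_or_lt with rfl | hlt
      · rw [← hcardU]; exact Finset.card_filter_le _ _
      · by_cases hJ : ∃ p ∈ P₀, ∃ z ∈ T p, c l z = J
        · obtain ⟨p, hp, z, hz, rfl⟩ := hJ
          refine le_trans (Finset.card_le_card ?_) ((hT p hp).2.2 l hlt hl' (c l z))
          intro w hw
          obtain ⟨hw, hwJ⟩ := Finset.mem_filter.1 hw
          obtain ⟨p', hp', hw⟩ := Finset.mem_biUnion.1 hw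
          -- A cell of level `l > k` lies in a single child cell.
          obtain rfl : p' = p := by
            refine hinj hp' hp ?_
            rw [← ((hT p' hp').1 w hw).2, ← ((hT p hp).1 z hz).2]
            exact hmono l (k + 1) hlt _ _ hwJ
          exact Finset.mem_filter.2 ⟨hw, hwJ⟩
        · rw [Finset.filter_eq_empty_iff.2]
          · simp
          · intro z hz hzJ
            obtain ⟨p, hp, hz⟩ := Finset.mem_biUnion.1 hz
            exact hJ ⟨p, hp, z, hz, hzJ⟩

/-! ### Lower bounds for Hausdorff dimension by open covers -/

/-- `HasContentGE s c F` says that the `s`-dimensional Hausdorff content of `F` is at least `c`,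
the content being taken over countable covers by open sets. -/
def HasContentGE {X : Type*} [PseudoEMetricSpace X] (s : ℝ) (c : ℝ≥0∞) (F : Set X) : Prop :=
  ∀ U : ℕ → Set X, (∀ i, IsOpen (U i)) → F ⊆ ⋃ i, U i → c ≤ ∑' i, Metric.ediam (U i) ^ s

lemma HasContentGE.le_dimH {X : Type*} [MetricSpace X] {s : ℝ≥0} (hs : 0 < s) {c : ℝ≥0∞}
    (hc : 0 < c) {F : Set X} (h : HasContentGE s c F) : (s : ℝ≥0∞) ≤ dimH F := by
  borelize X
  refine le_dimH_of_hausdorffMeasure_ne_zero fun h0 => ?_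
  obtain ⟨b, hb, hbc⟩ : ∃ b : ℝ≥0∞, 0 < b ∧ b < c := exists_between hc
  obtain ⟨b', hb', hbb'⟩ : ∃ b' : ℝ≥0∞, 0 < b' ∧ b' < b := exists_between hb
  have hfin : b' ≠ ∞ := (hbb'.trans hbc).ne_top
  rw [Measure.hausdorffMeasure_apply] at h0
  have h1 := le_of_eq h0
  simp only [iSup_le_iff] at h1
  have h2 := (h1 1 one_pos).trans_lt hb'
  simp only [iInf_lt_iff] at h2
  obtain ⟨t, htF, htd, hsum⟩ := h2
  obtain ⟨ε, hε, hεs⟩ := ENNReal.exists_pos_sum_of_countable' (tsub_pos_of_lt hbb').ne' ℕ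
  have hthick : ∀ i, ∃ δ : ℝ≥0, 0 < δ ∧
      Metric.ediam (Metric.thickening δ (t i)) ^ (s : ℝ) ≤
        (⨆ _ : (t i).Nonempty, Metric.ediam (t i) ^ (s : ℝ)) + ε i := by
    intro i
    rcases (t i).eq_empty_or_nonempty with he | hne
    · refine ⟨1, one_pos, ?_⟩
      simp [he, hs]
    · have hcont : Tendsto (fun δ : ℝ≥0 => (Metric.ediam (t i) + 2 * (δ : ℝ≥0∞)) ^ (s : ℝ))
          (𝓝[>] 0) (𝓝 ((Metric.ediam (t i) + 2 * ((0 : ℝ≥0) : ℝ≥0∞)) ^ (s : ℝ))) := by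
        refine Tendsto.mono_left ?_ nhdsWithin_le_nhds
        have : Continuous fun δ : ℝ≥0 => (Metric.ediam (t i) + 2 * (δ : ℝ≥0∞)) ^ (s : ℝ) := by
          refine ENNReal.continuous_rpow_const.comp (continuous_const.add ?_)
          exact (ENNReal.continuous_const_mul (by simp)).comp ENNReal.continuous_coe
        exact this.tendsto 0
      have hlt : (Metric.ediam (t i) + 2 * ((0 : ℝ≥0) : ℝ≥0∞)) ^ (s : ℝ) <
          Metric.ediam (t i) ^ (s : ℝ) + ε i := by
        simp only [ENNReal.coe_zero, mul_zero, add_zero]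
        refine ENNReal.lt_add_right ?_ (hε i).ne'
        exact ENNReal.rpow_ne_top_of_nonneg s.2 ((htd i).trans_lt ENNReal.one_lt_top).ne
      obtain ⟨δ, hδ, hδ0⟩ := ((hcont.eventually_lt_const hlt).and self_mem_nhdsWithin).exists
      refine ⟨δ, hδ0, ?_⟩
      rw [iSup_pos hne]
      exact (ENNReal.rpow_le_rpow (Metric.ediam_thickening_le δ) s.2).trans hδ.le
  choose δ hδ0 hδ using hthick
  have hcov := h (fun i => Metric.thickening (δ i) (t i)) (fun i => Metric.isOpen_thickening)
    (htF.trans (iUnion_mono fun i => Metric.self_subset_thickening (by exact_mod_cast hδ0 i) _))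
  have : c ≤ b := calc
    c ≤ _ := hcov
    _ ≤ ∑' i, ((⨆ _ : (t i).Nonempty, Metric.ediam (t i) ^ (s : ℝ)) + ε i) :=
      ENNReal.tsum_le_tsum hδ
    _ = (∑' i, ⨆ _ : (t i).Nonempty, Metric.ediam (t i) ^ (s : ℝ)) + ∑' i, ε i :=
      ENNReal.tsum_add
    _ ≤ b' + (b - b') := add_le_add hsum.le hεs.le
    _ = b := add_tsub_cancel_of_le hbb'.le
  exact absurd hbc (not_lt.2 this)

lemma exists_pos_dist_lt_imp_mem {X E : Type*} [TopologicalSpace X] [CompactSpace X]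
    [MetricSpace E] {f : X → E} (hf : Continuous f) {y : E} {W : Set X} (hW : IsOpen W)
    (h : f ⁻¹' {y} ⊆ W) : ∃ δ > 0, ∀ x, dist (f x) y < δ → x ∈ W := by
  have hK : IsCompact (f '' Wᶜ) := hW.isClosed_compl.isCompact.image hf
  have hy : y ∈ (f '' Wᶜ)ᶜ := by
    rintro ⟨x, hx, hxy⟩
    exact hx (h hxy)
  obtain ⟨δ, hδ, hsub⟩ := Metric.isOpen_iff.1 hK.isClosed.isOpen_compl y hy
  refine ⟨δ, hδ, fun x hx => ?_⟩
  by_contra hc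
  exact hsub (Metric.mem_ball.2 hx) ⟨x, hc, rfl⟩

/-- If an open cover of small content covers the fiber of `f` over `y`, then it also covers the
fiber over `y` of every map uniformly close to `f`, by compactness. -/
lemma isClosed_setOf_hasContentGE {X E : Type*} [MetricSpace X] [CompactSpace X]
    [MetricSpace E] (s : ℝ) (c : ℝ≥0∞) (V : Set E) :
    IsClosed {f : C(X, E) | ∀ y ∈ V, HasContentGE s c (f ⁻¹' {y})} := by
  rw [← isOpen_compl_iff, Metric.isOpen_iff]
  intro f hf
  simp only [mem_compl_iff, mem_ofPred_eq, HasContentGE, not_forall, not_le] at hf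
  obtain ⟨y, hy, U, hU, hcov, hlt⟩ := hf
  obtain ⟨δ, hδ, hδW⟩ :=
    exists_pos_dist_lt_imp_mem f.continuous (isOpen_iUnion hU) hcov
  refine ⟨δ, hδ, fun f' hf' hmem => ?_⟩
  refine absurd (hmem y hy U hU fun x hx => hδW x ?_) (not_le.2 hlt)
  have hx' : f' x = y := hx
  rw [← hx', dist_comm]
  exact (ContinuousMap.dist_apply_le_dist x).trans_lt (Metric.mem_ball.1 hf')

/-- A finite form of the mass distribution principle: it is enough to have, at every scale `r N`,
a finite set of approximate preimages that is spread out at scales above `r N`. -/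
lemma hasContentGE_of_finsets {X E : Type*} [MetricSpace X] [CompactSpace X]
    [MetricSpace E] {f : X → E} (hf : Continuous f) {y : E} {s : ℝ} (hs : 0 < s) {C : ℝ}
    {η r : ℕ → ℝ} (hη : Tendsto η atTop (𝓝 0)) (hr : Tendsto r atTop (𝓝 0))
    (P : ℕ → Finset X) (hP0 : ∀ N, (P N).Nonempty) (hPf : ∀ N, ∀ p ∈ P N, dist (f p) y ≤ η N)
    (hcount : ∀ N, ∀ u, r N ≤ u → ∀ U : Finset X, U ⊆ P N → (∀ p ∈ U, ∀ q ∈ U, dist p q ≤ u) →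
      (U.card : ℝ) ≤ C * u ^ s * (P N).card) :
    HasContentGE s (ENNReal.ofReal C)⁻¹ (f ⁻¹' {y}) := by
  classical
  intro U hU hcov
  have hK : IsCompact (f ⁻¹' {y}) := (isClosed_singleton.preimage hf).isCompact
  obtain ⟨T, hT⟩ := hK.elim_finite_subcover U hU hcov
  obtain ⟨δ, hδ, hδW⟩ := exists_pos_dist_lt_imp_mem hf
    (isOpen_biUnion fun i (_ : i ∈ T) => hU i) hT
  have hCpos : 0 ≤ C := by
    by_contra hC
    have h := hcount 0 (max 1 (r 0)) (le_max_right _ _) {(hP0 0).choose}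
      (by simpa using (hP0 0).choose_spec)
      (by simp)
    have h1 : (0:ℝ) < (max 1 (r 0)) ^ s := Real.rpow_pos_of_pos (by positivity) _
    have h2 : (0:ℝ) ≤ (P 0).card := by positivity
    simp only [Finset.card_singleton, Nat.cast_one] at h
    nlinarith [mul_nonneg h1.le h2,
      mul_nonneg (mul_nonneg h1.le h2) (neg_nonneg.2 (not_le.1 hC).le)]
  have hbdd : ∀ A : Set X, Bornology.IsBounded A := fun A =>
    (isCompact_univ.isBounded).subset (subset_univ A)
  have hdiam : ∀ i, ENNReal.ofReal (Metric.diam (U i)) = Metric.ediam (U i) := fun i =>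
    ENNReal.ofReal_toReal ((hbdd (U i)).ediam_ne_top)
  have hev : ∀ᶠ N in atTop, (1 : ℝ) ≤ ∑ i ∈ T, C * (max (Metric.diam (U i)) (r N)) ^ s := by
    filter_upwards [hη.eventually_lt_const hδ] with N hN
    have hsub : P N ⊆ T.biUnion fun i => (P N).filter fun p => p ∈ U i := by
      intro p hp
      obtain ⟨i, hi, hpi⟩ := mem_iUnion₂.1 (hδW p ((hPf N p hp).trans_lt hN))
      exact Finset.mem_biUnion.2 ⟨i, hi, Finset.mem_filter.2 ⟨hp, hpi⟩⟩
    have hcard : (0 : ℝ) < (P N).card := by exact_mod_cast (hP0 N).card_pos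
    have h1 : ((P N).card : ℝ) ≤
        ∑ i ∈ T, C * (max (Metric.diam (U i)) (r N)) ^ s * (P N).card := by
      calc ((P N).card : ℝ) ≤ ((T.biUnion fun i => (P N).filter fun p => p ∈ U i).card : ℝ) := by
            exact_mod_cast Finset.card_le_card hsub
        _ ≤ ∑ i ∈ T, (((P N).filter fun p => p ∈ U i).card : ℝ) := by
            exact_mod_cast Finset.card_biUnion_le
        _ ≤ _ := Finset.sum_le_sum fun i _ =>
            hcount N _ (le_max_right _ _) _ (Finset.filter_subset _ _) fun p hp q hq =>
              (Metric.dist_le_diam_of_mem (hbdd _) (Finset.mem_filter.1 hp).2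
                (Finset.mem_filter.1 hq).2).trans (le_max_left _ _)
    rw [← Finset.sum_mul] at h1
    exact le_of_mul_le_mul_right (by linarith) hcard
  have hlim : Tendsto (fun N => ∑ i ∈ T, C * (max (Metric.diam (U i)) (r N)) ^ s) atTop
      (𝓝 (∑ i ∈ T, C * (Metric.diam (U i)) ^ s)) := by
    refine tendsto_finsetSum _ fun i _ => Tendsto.const_mul _ ?_
    have : Tendsto (fun N => max (Metric.diam (U i)) (r N)) atTop
        (𝓝 (max (Metric.diam (U i)) 0)) := tendsto_const_nhds.max hr
    rw [max_eq_left Metric.diam_nonneg] at this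
    exact this.rpow_const (Or.inr hs.le)
  have hone := ge_of_tendsto hlim hev
  have hone' : (1 : ℝ≥0∞) ≤ ENNReal.ofReal C * ∑' i, Metric.ediam (U i) ^ s := calc
    (1 : ℝ≥0∞) ≤ ENNReal.ofReal (∑ i ∈ T, C * (Metric.diam (U i)) ^ s) := by
        simpa using ENNReal.ofReal_le_ofReal hone
    _ = ∑ i ∈ T, ENNReal.ofReal C * Metric.ediam (U i) ^ s := by
        rw [ENNReal.ofReal_sum_of_nonneg]
        · refine Finset.sum_congr rfl fun i _ => ?_
          rw [ENNReal.ofReal_mul hCpos, ← hdiam,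
            ENNReal.ofReal_rpow_of_nonneg Metric.diam_nonneg hs.le]
        · intro i _
          have := @Metric.diam_nonneg _ (U i) _
          positivity
    _ = ENNReal.ofReal C * ∑ i ∈ T, Metric.ediam (U i) ^ s := by rw [Finset.mul_sum]
    _ ≤ _ := by gcongr; exact ENNReal.sum_le_tsum T
  rw [ENNReal.inv_le_iff_le_mul]
  · exact hone'
  · intro _ h; simp [h] at hone'
  · exact fun h => absurd h ENNReal.ofReal_ne_top

/-! ### Independent uniform labels -/

section Labels

variable {I V : Type*} [MeasurableSpace V] [MeasurableSingletonClass V] {ν : Measure V}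
  [IsProbabilityMeasure ν] {p : ℝ} {v : V}

/-- A Chernoff bound, obtained from Markov's inequality for `2 ^ (-X)`, where `X` is the number of
labels in `T` equal to `v`. -/
lemma measure_card_label_lt_le [DecidableEq V] (hp : 0 < p) (hν : ν {v} = ENNReal.ofReal p)
    (T : Finset I) (L : ℕ) {b : ℝ} (hb : 0 < b) (hbT : b ≤ p * T.card) (hL : 4 * (L : ℝ) ≤ b) :
    Measure.infinitePi (fun _ : I => ν) {ω | (T.filter fun i => ω i = v).card < L} ≤
      ENNReal.ofReal (4 / b) := by
  set μ := Measure.infinitePi (fun _ : I => ν)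
  let h : V → ℝ≥0∞ := fun w => if w = v then ENNReal.ofReal (1 / 2) else 1
  have hh : Measurable h := Measurable.ite (measurableSet_singleton v) measurable_const
    measurable_const
  have hp1 : p ≤ 1 := by
    have : ENNReal.ofReal p ≤ 1 := hν ▸ prob_le_one
    simpa using this
  have hint : ∫⁻ w, h w ∂ν = ENNReal.ofReal (1 - p / 2) := by
    have h1 : h = fun w => ({v} : Set V).indicator (fun _ => ENNReal.ofReal (1 / 2)) w +
        ({v}ᶜ : Set V).indicator (fun _ => 1) w := by
      ext w
      by_cases hw : w = v <;> simp [h, hw]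
    rw [h1, lintegral_add_left (measurable_const.indicator (measurableSet_singleton v)),
      lintegral_indicator_const (measurableSet_singleton v),
      lintegral_indicator_const (measurableSet_singleton v).compl,
      prob_compl_eq_one_sub (measurableSet_singleton v), hν, ← ENNReal.ofReal_one,
      ← ENNReal.ofReal_sub _ hp.le, ← ENNReal.ofReal_mul (by norm_num),
      ← ENNReal.ofReal_mul (by norm_num), ← ENNReal.ofReal_add (by positivity) (by linarith)]
    congr 1; ring
  have hprod : ∫⁻ ω, ∏ i ∈ T, h (ω i) ∂μ = ENNReal.ofReal ((1 - p / 2) ^ T.card) := by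
    rw [lintegral_prod_eq_prod_lintegral_of_indepFun T (fun i (ω : I → V) => h (ω i))
      (iIndepFun_infinitePi (P := fun _ : I => ν) fun _ => hh)
      (fun i => hh.comp (measurable_pi_apply i))]
    have : ∀ i, ∫⁻ ω, h (ω i) ∂μ = ENNReal.ofReal (1 - p / 2) := fun i => by
      rw [← hint]
      exact (measurePreserving_eval_infinitePi (fun _ : I => ν) i).lintegral_comp hh
    rw [Finset.prod_congr rfl fun i _ => this i, Finset.prod_const,
      ENNReal.ofReal_pow (by linarith)]
  have hmarkov : ENNReal.ofReal ((1 / 2) ^ L) *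
      μ {ω | (T.filter fun i => ω i = v).card < L} ≤ ENNReal.ofReal ((1 - p / 2) ^ T.card) := by
    rw [← hprod]
    have hmeas : Measurable fun ω : I → V => ∏ i ∈ T, h (ω i) :=
      Finset.measurable_fun_prod _ fun i _ => hh.comp (measurable_pi_apply i)
    refine le_trans ?_ (mul_meas_ge_le_lintegral₀ hmeas.aemeasurable (ENNReal.ofReal ((1 / 2) ^ L)))
    gcongr with ω
    intro hω
    simp only [h]
    rw [Finset.prod_ite, Finset.prod_const, Finset.prod_const_one, mul_one,
      ← ENNReal.ofReal_pow (by norm_num)]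
    exact ENNReal.ofReal_le_ofReal
      (pow_le_pow_of_le_one (by norm_num) (by norm_num) hω.le)
  have hreal : (1 - p / 2) ^ T.card ≤ (1 / 2 : ℝ) ^ L * (4 / b) := by
    have h1 : (1 - p / 2) ^ T.card ≤ Real.exp (-(b / 2)) := calc
      (1 - p / 2) ^ T.card ≤ (Real.exp (-(p / 2))) ^ T.card := by
        gcongr
        · linarith
        · have := Real.add_one_le_exp (-(p / 2)); linarith
      _ = Real.exp (-(p * T.card / 2)) := by rw [← Real.exp_nat_mul]; congr 1; ring
      _ ≤ _ := Real.exp_le_exp.2 (by linarith)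
    have h2 : Real.exp (-(b / 4)) ≤ (1 / 2 : ℝ) ^ L := calc
      Real.exp (-(b / 4)) ≤ Real.exp (-(L : ℝ)) := Real.exp_le_exp.2 (by linarith)
      _ = (Real.exp (-1)) ^ L := by rw [← Real.exp_nat_mul]; congr 1; ring
      _ ≤ _ := by
        gcongr
        have := Real.add_one_le_exp (1 : ℝ)
        rw [Real.exp_neg, one_div]
        exact inv_anti₀ (by norm_num) (by linarith)
    have h3 : Real.exp (-(b / 4)) ≤ 4 / b := by
      have := Real.add_one_le_exp (b / 4)
      rw [Real.exp_neg, ← inv_div b 4]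
      exact inv_anti₀ (by positivity) (by linarith)
    calc _ ≤ _ := h1
      _ = Real.exp (-(b / 4)) * Real.exp (-(b / 4)) := by rw [← Real.exp_add]; congr 1; ring
      _ ≤ _ := by gcongr
  have hpos : (0 : ℝ) < (1 / 2) ^ L := by positivity
  rw [← ENNReal.mul_le_mul_iff_right (a := ENNReal.ofReal ((1 / 2) ^ L)) (by simp)
    ENNReal.ofReal_ne_top, ← ENNReal.ofReal_mul hpos.le]
  exact hmarkov.trans (ENNReal.ofReal_le_ofReal hreal)

lemma ae_frequently_label_eq (hp : 0 < p) (hν : ν {v} = ENNReal.ofReal p) {e : ℕ → I}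
    (he : Function.Injective e) :
    ∀ᵐ ω ∂Measure.infinitePi (fun _ : I => ν), ∀ n₀ : ℕ, ∃ n, n₀ ≤ n ∧ ω (e n) = v := by
  classical
  rw [ae_all_iff]
  intro n₀
  rw [ae_iff]
  have hle : ∀ N : ℕ, Measure.infinitePi (fun _ : I => ν)
      {ω | ¬ ∃ n, n₀ ≤ n ∧ ω (e n) = v} ≤ (1 - ENNReal.ofReal p) ^ N := by
    intro N
    let A : Finset I := (Finset.Ico n₀ (n₀ + N)).image e
    have hA : A.card = N := by
      rw [Finset.card_image_of_injective _ he]; simp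
    calc _ ≤ Measure.infinitePi (fun _ : I => ν) (Set.pi A fun _ => {v}ᶜ) := by
          refine measure_mono fun ω hω i hi => ?_
          obtain ⟨n, hn, rfl⟩ := Finset.mem_image.1 (Finset.mem_coe.1 hi)
          exact fun h => hω ⟨n, (Finset.mem_Ico.1 hn).1, h⟩
      _ = _ := by
          rw [Measure.infinitePi_pi _ fun _ _ => (measurableSet_singleton v).compl]
          rw [Finset.prod_const, hA, prob_compl_eq_one_sub (measurableSet_singleton v), hν]
  refine le_antisymm (ge_of_tendsto' (x := atTop) ?_ hle) bot_le
  refine ENNReal.tendsto_pow_atTop_nhds_zero_of_lt_one ?_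
  exact ENNReal.sub_lt_self ENNReal.one_ne_top one_ne_zero (by simpa using hp)

/-- If in each of finitely many groups `T n a`, `a ∈ A n`, of labels at stage `n` the expected
number of labels equal to `v` is at least `b n`, and `∑ #(A n) / b n` converges, then almost surely
at all late stages every value occurs at least `b n / 4` times in every group. -/
lemma ae_eventually_card_label_ge {α κ V : Type*} [Fintype V] [DecidableEq V] [MeasurableSpace V]
    [MeasurableSingletonClass V] {ν : Measure V} [IsProbabilityMeasure ν] {p : ℝ} (hp : 0 < p)
    (hν : ∀ v, ν {v} = ENNReal.ofReal p)
    (A : ℕ → Finset α) (T : ℕ → α → Finset κ) (L : ℕ → ℕ) (b : ℕ → ℝ) (n₀ : ℕ)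
    (hb : ∀ n, 0 < b n) (hbT : ∀ n, n₀ ≤ n → ∀ a ∈ A n, b n ≤ p * (T n a).card)
    (hL : ∀ n, n₀ ≤ n → 4 * (L n : ℝ) ≤ b n)
    (hsum : Summable fun n => ((A n).card : ℝ) / b n) :
    ∀ᵐ ω ∂Measure.infinitePi (fun _ : ℕ × κ => ν), ∃ n₁, n₀ ≤ n₁ ∧ ∀ n, n₁ ≤ n → ∀ a ∈ A n,
      ∀ v, L n ≤ ((T n a).filter fun J => ω (n, J) = v).card := by
  classical
  set μ := Measure.infinitePi (fun _ : ℕ × κ => ν)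
  let bad : ℕ → Set (ℕ × κ → V) := fun n => if n₀ ≤ n then
    ⋃ a ∈ A n, ⋃ v ∈ (Finset.univ : Finset V),
      {ω | ((T n a).filter fun J => ω (n, J) = v).card < L n} else ∅
  have hbad : ∀ n, μ (bad n) ≤ ENNReal.ofReal (4 * Fintype.card V * ((A n).card / b n)) := by
    intro n
    by_cases hn : n₀ ≤ n
    · simp only [bad, if_pos hn]
      have hone : ∀ a ∈ A n, ∀ v, μ {ω | ((T n a).filter fun J => ω (n, J) = v).card < L n} ≤
          ENNReal.ofReal (4 / b n) := by
        intro a ha v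
        have hmap : (T n a).card =
            ((T n a).map ⟨fun J => (n, J), Prod.mk_right_injective n⟩).card :=
          (Finset.card_map _).symm
        refine le_trans (le_of_eq ?_) (measure_card_label_lt_le (v := v) hp (hν v)
          ((T n a).map ⟨fun J => (n, J), Prod.mk_right_injective n⟩) (L n) (hb n)
          (hmap ▸ hbT n hn a ha) (hL n hn))
        congr 1
        ext ω
        simp only [mem_ofPred_eq, Finset.filter_map, Finset.card_map]
        rfl
      calc _ ≤ ∑ a ∈ A n, ∑ v ∈ (Finset.univ : Finset V),
            μ {ω | ((T n a).filter fun J => ω (n, J) = v).card < L n} :=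
            (measure_biUnion_finset_le _ _).trans
              (Finset.sum_le_sum fun a _ => measure_biUnion_finset_le _ _)
        _ ≤ ∑ a ∈ A n, ∑ v ∈ (Finset.univ : Finset V), ENNReal.ofReal (4 / b n) :=
            Finset.sum_le_sum fun a ha => Finset.sum_le_sum fun v _ => hone a ha v
        _ = _ := by
            have : (0 : ℝ) ≤ 4 / b n := by have := hb n; positivity
            simp only [Finset.sum_const, nsmul_eq_mul, Finset.card_univ]
            rw [← ENNReal.ofReal_natCast, ← ENNReal.ofReal_natCast, ← ENNReal.ofReal_mul (by simp),
              ← ENNReal.ofReal_mul (by simp)]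
            congr 1; ring
    · simp [bad, if_neg hn]
  have htsum : ∑' n, μ (bad n) ≠ ∞ := by
    refine ne_top_of_le_ne_top ?_ (ENNReal.tsum_le_tsum hbad)
    exact (hsum.mul_left (4 * (Fintype.card V : ℝ))).tsum_ofReal_ne_top
  filter_upwards [ae_eventually_notMem htsum] with ω hω
  obtain ⟨n₁, hn₁⟩ := eventually_atTop.1 hω
  refine ⟨max n₀ n₁, le_max_left _ _, fun n hn a ha v => ?_⟩
  by_contra hc
  refine hn₁ n (le_of_max_le_right hn) ?_
  simp only [bad, if_pos (le_of_max_le_left hn)]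
  exact mem_biUnion ha (mem_biUnion (Finset.mem_coe.2 (Finset.mem_univ v)) (not_le.1 hc))

end Labels

/-! ### Nested grids on the cube -/

/-- The number of intervals into which the grid of level `n` divides `[0,1]`. -/
def gridSize (n : ℕ) : ℕ := 2 ^ 4 ^ n

lemma gridSize_pos (n : ℕ) : 0 < gridSize n := by unfold gridSize; positivity

lemma gridSize_cast_pos (n : ℕ) : (0 : ℝ) < gridSize n := by exact_mod_cast gridSize_pos n

lemma gridSize_succ (n : ℕ) : gridSize (n + 1) = gridSize n * 2 ^ (3 * 4 ^ n) := by
  unfold gridSize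
  rw [← pow_add]
  congr 1
  ring

lemma gridSize_mono : Monotone gridSize := fun a b h => by
  unfold gridSize
  gcongr <;> norm_num

lemma tendsto_inv_gridSize : Tendsto (fun n => (gridSize n : ℝ)⁻¹) atTop (𝓝 0) := by
  refine tendsto_inv_atTop_zero.comp (tendsto_natCast_atTop_atTop.comp ?_)
  refine tendsto_atTop_mono (fun n => ?_) tendsto_id
  have h1 : n < 4 ^ n := Nat.lt_pow_self (by norm_num)
  have h2 : 4 ^ n < 2 ^ 4 ^ n := Nat.lt_pow_self (by norm_num)
  simp only [id, gridSize]
  omega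

section Grid

variable {m : ℕ}

/-- The index of the grid cell of level `n` containing `x`. -/
noncomputable def gridCell (n : ℕ) (x : unitCube m) : Fin m → ℕ :=
  fun i => ⌊(gridSize n : ℝ) * x.1 i⌋₊

/-- The union of the cores of the grid cells of level `n`: the points whose distance from the walls
of their cell is at least `4⁻ⁿ` times the side of the cell, coordinatewise. -/
def gridCore (m n : ℕ) : Set (unitCube m) :=
  {x | ∀ i, Int.fract ((gridSize n : ℝ) * x.1 i) ∈ Icc ((1 / 4 : ℝ) ^ n) (1 - (1 / 4) ^ n)}

lemma gridSize_mul_nonneg (n : ℕ) (x : unitCube m) (i : Fin m) :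
    0 ≤ (gridSize n : ℝ) * x.1 i := mul_nonneg (gridSize_cast_pos n).le (x.2 i).1

lemma gridCell_eq_succ_div (n : ℕ) (x : unitCube m) (i : Fin m) :
    gridCell n x i = gridCell (n + 1) x i / 2 ^ (3 * 4 ^ n) := by
  unfold gridCell
  have h : (2 : ℕ) ^ (3 * 4 ^ n) ≠ 0 := by positivity
  rw [← Nat.mul_cast_floor_div_cancel (R := ℝ) h, gridSize_succ]
  push_cast
  congr 2
  ring

lemma gridCell_eq_of_succ_eq (n : ℕ) (x y : unitCube m)
    (h : gridCell (n + 1) x = gridCell (n + 1) y) : gridCell n x = gridCell n y := by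
  ext i
  rw [gridCell_eq_succ_div n x, gridCell_eq_succ_div n y, h]

lemma measurable_coord (i : Fin m) : Measurable fun x : unitCube m => x.1 i := by
  have : Continuous fun x : unitCube m => x.1 i := by fun_prop
  exact this.measurable

lemma measurable_gridCell (n : ℕ) : Measurable (gridCell (m := m) n) :=
  measurable_pi_lambda _ fun i => Nat.measurable_floor.comp ((measurable_coord i).const_mul _)

lemma measurableSet_gridCore (n : ℕ) : MeasurableSet (gridCore m n) := by
  have : gridCore m n = ⋂ i, (fun x : unitCube m => Int.fract ((gridSize n : ℝ) * x.1 i)) ⁻¹'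
      Icc ((1 / 4 : ℝ) ^ n) (1 - (1 / 4) ^ n) := by
    ext x; simp [gridCore]
  rw [this]
  exact MeasurableSet.iInter fun i =>
    (measurable_fract.comp ((measurable_coord i).const_mul _)) measurableSet_Icc

lemma floor_add_fract_coord (n : ℕ) (x : unitCube m) (i : Fin m) :
    (gridCell n x i : ℝ) + Int.fract ((gridSize n : ℝ) * x.1 i) = gridSize n * x.1 i := by
  unfold gridCell
  rw [natCast_floor_eq_intCast_floor (gridSize_mul_nonneg n x i), Int.floor_add_fract]

/-- The set of indices of grid cells of level `n`. -/
def gridIndices (m n : ℕ) : Finset (Fin m → ℕ) :=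
  Fintype.piFinset fun _ => Finset.range (gridSize n)

lemma card_gridIndices (m n : ℕ) : (gridIndices m n).card = gridSize n ^ m := by
  simp [gridIndices]

lemma gridCell_mem_gridIndices {n : ℕ} {x : unitCube m} (hx : x ∈ gridCore m n) :
    gridCell n x ∈ gridIndices m n := by
  refine Fintype.mem_piFinset.2 fun i => Finset.mem_range.2 ?_
  have h1 := floor_add_fract_coord n x i
  have h2 : 0 < Int.fract ((gridSize n : ℝ) * x.1 i) := lt_of_lt_of_le (by positivity) (hx i).1
  have h3 : (gridSize n : ℝ) * x.1 i ≤ gridSize n * 1 :=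
    mul_le_mul_of_nonneg_left (x.2 i).2 (gridSize_cast_pos n).le
  have : (gridCell n x i : ℝ) < gridSize n := by linarith
  exact_mod_cast this

lemma measurableSet_unitCube (m : ℕ) : MeasurableSet (unitCube m) :=
  (isCompact_unitCube m).measurableSet

/-- Lebesgue measure on the cube. -/
noncomputable instance measureSpace_unitCube : MeasureSpace (unitCube m) :=
  Measure.Subtype.measureSpace

lemma volume_setOf_coord_mem_Icc (a b : Fin m → ℝ) :
    volume {x : unitCube m | ∀ i, x.1 i ∈ Icc (a i) (b i)} =
      volume (Icc a b ∩ Icc (0 : Fin m → ℝ) 1) := by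
  rw [Measure.Subtype.volume_def, comap_subtype_coe_apply (measurableSet_unitCube m),
    ← (PiLp.volume_preserving_ofLp (Fin m)).measure_preimage
      (measurableSet_Icc.inter measurableSet_Icc).nullMeasurableSet]
  congr 1
  ext x
  simp only [mem_image, Subtype.exists, mem_ofPred_eq, mem_preimage, mem_inter_iff, mem_Icc,
    Pi.le_def, unitCube]
  constructor
  · rintro ⟨y, hy, h, rfl⟩
    exact ⟨⟨fun i => (h i).1, fun i => (h i).2⟩, fun i => (hy i).1, fun i => (hy i).2⟩
  · rintro ⟨⟨h1, h2⟩, h3, h4⟩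
    exact ⟨x, fun i => ⟨h3 i, h4 i⟩, fun i => ⟨h1 i, h2 i⟩, rfl⟩

instance isProbabilityMeasure_volume_unitCube :
    IsProbabilityMeasure (volume : Measure (unitCube m)) := by
  constructor
  have h := volume_setOf_coord_mem_Icc (m := m) 0 1
  rw [inter_self, Real.volume_Icc_pi] at h
  have h2 : {x : unitCube m | ∀ i, x.1 i ∈ Icc ((0 : Fin m → ℝ) i) ((1 : Fin m → ℝ) i)} = univ :=
    eq_univ_of_forall fun x i => x.2 i
  rw [h2] at h
  simpa using h

lemma volume_gridCell_preimage_le (n : ℕ) (J : Fin m → ℕ) :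
    volume (gridCell n ⁻¹' {J} : Set (unitCube m)) ≤ ENNReal.ofReal (((gridSize n : ℝ) ^ m)⁻¹) := by
  have hD := gridSize_cast_pos n
  calc volume (gridCell n ⁻¹' {J} : Set (unitCube m))
      ≤ volume {x : unitCube m | ∀ i, x.1 i ∈
          Icc ((J i : ℝ) / gridSize n) ((J i + 1 : ℝ) / gridSize n)} := by
        refine measure_mono fun x hx i => ?_
        have hx' : gridCell n x = J := hx
        have h1 := floor_add_fract_coord n x i
        have h2 := Int.fract_nonneg ((gridSize n : ℝ) * x.1 i)
        have h3 := Int.fract_lt_one ((gridSize n : ℝ) * x.1 i)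
        rw [hx'] at h1
        constructor
        · rw [div_le_iff₀ hD]; linarith
        · rw [le_div_iff₀ hD]; linarith
    _ ≤ volume (Icc (fun i => (J i : ℝ) / gridSize n) (fun i => (J i + 1 : ℝ) / gridSize n)) := by
        rw [volume_setOf_coord_mem_Icc]
        exact measure_mono inter_subset_left
    _ = _ := by
        rw [Real.volume_Icc_pi]
        have : ∀ i, (J i + 1 : ℝ) / gridSize n - (J i : ℝ) / gridSize n = (gridSize n : ℝ)⁻¹ :=
          fun i => by field_simp; ring
        simp only [this, Finset.prod_const, Finset.card_univ, Fintype.card_fin]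
        rw [← ENNReal.ofReal_pow (by positivity), inv_pow]

lemma volume_gridCore_compl_le {n : ℕ} (hn : 1 ≤ n) :
    volume (gridCore m n)ᶜ ≤ ENNReal.ofReal (2 * m * (1 / 4) ^ n) := by
  have hD := gridSize_cast_pos n
  set δ : ℝ := (1 / 4) ^ n with hδ
  have hδ0 : 0 < δ := by positivity
  have hδ1 : δ ≤ 1 / 4 := by
    calc δ ≤ (1 / 4) ^ 1 := pow_le_pow_of_le_one (by norm_num) (by norm_num) hn
      _ = _ := by norm_num
  have hcell : ∀ J ∈ gridIndices m n, volume (gridCore m n ∩ gridCell n ⁻¹' {J}) =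
      ENNReal.ofReal (((1 - 2 * δ) / gridSize n) ^ m) := by
    intro J hJ
    have hset : gridCore m n ∩ gridCell n ⁻¹' {J} = {x : unitCube m | ∀ i, x.1 i ∈
        Icc ((J i + δ : ℝ) / gridSize n) ((J i + (1 - δ) : ℝ) / gridSize n)} := by
      ext x
      simp only [mem_inter_iff, mem_preimage, mem_singleton_iff, mem_ofPred_eq, mem_Icc,
        div_le_iff₀ hD, le_div_iff₀ hD]
      constructor
      · rintro ⟨h, hx⟩ i
        have h1 := floor_add_fract_coord n x i
        have h2 := h i
        rw [hx] at h1
        rw [mem_Icc] at h2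
        constructor <;> linarith
      · intro h
        have hx : gridCell n x = J := by
          ext i
          refine (Nat.floor_eq_iff (gridSize_mul_nonneg n x i)).2 ?_
          have := h i
          constructor <;> linarith
        refine ⟨fun i => ?_, hx⟩
        have h1 := floor_add_fract_coord n x i
        have h2 := h i
        rw [hx] at h1
        rw [mem_Icc]
        constructor <;> linarith
    rw [hset, volume_setOf_coord_mem_Icc, inter_eq_left.2, Real.volume_Icc_pi]
    · have : ∀ i, (J i + (1 - δ) : ℝ) / gridSize n - (J i + δ : ℝ) / gridSize n =
          (1 - 2 * δ) / gridSize n := fun i => by rw [← sub_div]; congr 1; ring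
      simp only [this, Finset.prod_const, Finset.card_univ, Fintype.card_fin]
      rw [← ENNReal.ofReal_pow]
      exact div_nonneg (by linarith) hD.le
    · refine Icc_subset_Icc (fun i => ?_) (fun i => ?_)
      · simp only [Pi.zero_apply]; positivity
      · simp only [Pi.one_apply]
        rw [div_le_one hD]
        have h : J i < gridSize n := Finset.mem_range.1 (Fintype.mem_piFinset.1 hJ i)
        have : (J i : ℝ) + 1 ≤ gridSize n := by exact_mod_cast h
        linarith
  have hge : ENNReal.ofReal (1 - 2 * m * δ) ≤ volume (gridCore m n) := by
    calc ENNReal.ofReal (1 - 2 * m * δ) ≤ ENNReal.ofReal ((1 - 2 * δ) ^ m) := by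
          refine ENNReal.ofReal_le_ofReal ?_
          have := one_add_mul_le_pow (a := -(2 * δ)) (by linarith) m
          rw [← sub_eq_add_neg] at this
          linarith
      _ = ∑ J ∈ gridIndices m n, volume (gridCore m n ∩ gridCell n ⁻¹' {J}) := by
          rw [Finset.sum_congr rfl hcell, Finset.sum_const, card_gridIndices, nsmul_eq_mul,
            ← ENNReal.ofReal_natCast, ← ENNReal.ofReal_mul (by positivity)]
          congr 1
          push_cast
          rw [← mul_pow]
          congr 1
          field_simp
      _ = volume (⋃ J ∈ gridIndices m n, gridCore m n ∩ gridCell n ⁻¹' {J}) := by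
          rw [measure_biUnion_finset]
          · intro J _ J' _ hne
            refine disjoint_left.2 fun x hx hx' => hne ?_
            rw [← show gridCell n x = J from hx.2, show gridCell n x = J' from hx'.2]
          · exact fun J _ => (measurableSet_gridCore n).inter
              (measurable_gridCell n (measurableSet_singleton J))
      _ ≤ _ := measure_mono (iUnion₂_subset fun J _ => inter_subset_left)
  rw [prob_compl_eq_one_sub (measurableSet_gridCore n)]
  refine tsub_le_iff_left.2 ?_
  calc (1 : ℝ≥0∞) = ENNReal.ofReal ((1 - 2 * m * δ) + 2 * m * δ) := by simp
    _ ≤ ENNReal.ofReal (1 - 2 * m * δ) + ENNReal.ofReal (2 * m * δ) := ENNReal.ofReal_add_le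
    _ ≤ _ := by gcongr

lemma abs_coord_sub_le (x y : unitCube m) (i : Fin m) : |x.1 i - y.1 i| ≤ dist x y := by
  rw [Subtype.dist_eq, dist_eq_norm]
  simpa using PiLp.norm_apply_le (x.1 - y.1) i

lemma card_image_gridCell_le {n : ℕ} {u : ℝ} (hu : 1 ≤ u * gridSize n) (U : Finset (unitCube m))
    (hU : ∀ p ∈ U, ∀ q ∈ U, dist p q ≤ u) :
    ((U.image (gridCell n)).card : ℝ) ≤ (4 * (u * gridSize n)) ^ m := by
  classical
  have hD := gridSize_cast_pos n
  rcases U.eq_empty_or_nonempty with rfl | ⟨x₀, hx₀⟩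
  · simp only [Finset.image_empty, Finset.card_empty, Nat.cast_zero]; positivity
  set w := u * gridSize n with hw
  let lo : Fin m → ℕ := fun i => ⌊gridSize n * x₀.1 i - w⌋₊
  let hi : Fin m → ℕ := fun i => ⌊gridSize n * x₀.1 i + w⌋₊
  have hsub : U.image (gridCell n) ⊆ Fintype.piFinset fun i => Finset.Icc (lo i) (hi i) := by
    intro J hJ
    obtain ⟨x, hx, rfl⟩ := Finset.mem_image.1 hJ
    refine Fintype.mem_piFinset.2 fun i => ?_
    have h := (abs_coord_sub_le x x₀ i).trans (hU x hx x₀ hx₀)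
    have h' : |gridSize n * x.1 i - gridSize n * x₀.1 i| ≤ w := by
      rw [← mul_sub, abs_mul, abs_of_pos hD, hw, mul_comm]
      gcongr
    rw [abs_le] at h'
    exact Finset.mem_Icc.2 ⟨Nat.floor_mono (by linarith), Nat.floor_mono (by linarith)⟩
  have hlen : ∀ i, ((Finset.Icc (lo i) (hi i)).card : ℝ) ≤ 4 * w := by
    intro i
    rw [Nat.card_Icc]
    have h1 : gridSize n * x₀.1 i - w < lo i + 1 := Nat.lt_floor_add_one _
    have h2 : (hi i : ℝ) ≤ gridSize n * x₀.1 i + w :=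
      Nat.floor_le (add_nonneg (gridSize_mul_nonneg n x₀ i) (by linarith))
    rcases le_total (lo i) (hi i + 1) with h | h
    · rw [Nat.cast_sub h]; push_cast; linarith
    · rw [Nat.sub_eq_zero_of_le h]; simp; linarith
  calc ((U.image (gridCell n)).card : ℝ)
      ≤ ((Fintype.piFinset fun i => Finset.Icc (lo i) (hi i)).card : ℝ) := by
        exact_mod_cast Finset.card_le_card hsub
    _ = ∏ i, ((Finset.Icc (lo i) (hi i)).card : ℝ) := by rw [Fintype.card_piFinset]; push_cast; rfl
    _ ≤ ∏ _i : Fin m, 4 * w := Finset.prod_le_prod (fun i _ => by positivity) fun i _ => hlen i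
    _ = _ := by simp

end Grid

/-! ### The random map -/

/-- The alphabet of the random labels: each coordinate takes one of `16` values. -/
abbrev Label (d : ℕ) : Type := Fin d → Fin 16

/-- The vector encoded by a label, with coordinates in `{-8, …, 7}`. -/
noncomputable def labelVec {d : ℕ} (w : Label d) : EuclideanSpace ℝ (Fin d) :=
  WithLp.toLp 2 fun i => ((w i : ℕ) : ℝ) - 8

lemma abs_labelVec_le {d : ℕ} (w : Label d) (i : Fin d) : |labelVec w i| ≤ 8 := by
  have h : ((w i : ℕ) : ℝ) ≤ 15 := by exact_mod_cast Nat.lt_succ_iff.1 (w i).2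
  have h0 : (0 : ℝ) ≤ ((w i : ℕ) : ℝ) := by positivity
  simp only [labelVec]
  rw [abs_le]
  constructor <;> linarith

lemma labelVec_const_eight (d : ℕ) : labelVec (fun _ => 8 : Label d) = 0 := by
  ext i
  simp [labelVec]

/-- Every vector with coordinates in `[-8, 8)` is rounded down to the vector of some label. -/
lemma exists_label_sub_mem_Ico {d : ℕ} {r : Fin d → ℝ} (hr : ∀ i, r i ∈ Ico (-8 : ℝ) 8) :
    ∃ w : Label d, ∀ i, r i - labelVec w i ∈ Ico (0 : ℝ) 1 := by
  have h : ∀ i, ⌊r i + 8⌋₊ < 16 := fun i => by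
    have := (hr i).2
    refine (Nat.floor_lt (by linarith [(hr i).1])).2 ?_
    push_cast
    linarith
  refine ⟨fun i => ⟨⌊r i + 8⌋₊, h i⟩, fun i => ?_⟩
  have h1 : (⌊r i + 8⌋₊ : ℝ) ≤ r i + 8 := Nat.floor_le (by linarith [(hr i).1])
  have h2 := Nat.lt_floor_add_one (r i + 8)
  simp only [labelVec, mem_Ico]
  constructor <;> linarith

/-- The trapezoid function that is `1` on `[δ, 1 - δ]` and `0` outside `(0, 1)`. -/
noncomputable def trapezoid (δ t : ℝ) : ℝ := max 0 (min 1 (min t (1 - t) / δ))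

lemma trapezoid_nonneg (δ t : ℝ) : 0 ≤ trapezoid δ t := le_max_left _ _

lemma trapezoid_le_one (δ t : ℝ) : trapezoid δ t ≤ 1 := max_le zero_le_one (min_le_left _ _)

lemma trapezoid_eq_one {δ t : ℝ} (hδ : 0 < δ) (ht : t ∈ Icc δ (1 - δ)) : trapezoid δ t = 1 := by
  have h : δ ≤ min t (1 - t) := le_min ht.1 (by linarith [ht.2])
  have : 1 ≤ min t (1 - t) / δ := (one_le_div hδ).2 h
  rw [trapezoid, min_eq_left this, max_eq_right zero_le_one]

lemma trapezoid_eq_zero {δ t : ℝ} (hδ : 0 < δ) (ht : t ∉ Ioo 0 1) : trapezoid δ t = 0 := by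
  have h : min t (1 - t) ≤ 0 := by
    by_contra hc
    push Not at hc
    exact ht ⟨(lt_min_iff.1 hc).1, by linarith [(lt_min_iff.1 hc).2]⟩
  have : min t (1 - t) / δ ≤ 0 := div_nonpos_of_nonpos_of_nonneg h hδ.le
  rw [trapezoid, max_eq_left ((min_le_right _ _).trans this)]

@[fun_prop]
lemma continuous_trapezoid (δ : ℝ) : Continuous (trapezoid δ) := by
  unfold trapezoid
  fun_prop

section RandomMap

variable {m d : ℕ}

/-- A continuous function that is `1` on the core of the grid cell `k` of level `n` and vanishes
outside the interior of this cell. -/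
noncomputable def gridBump (n : ℕ) (k : Fin m → ℕ) (x : unitCube m) : ℝ :=
  ∏ i, trapezoid ((1 / 4) ^ n) (gridSize n * x.1 i - k i)

@[fun_prop]
lemma continuous_gridBump (n : ℕ) (k : Fin m → ℕ) : Continuous (gridBump n k) := by
  unfold gridBump
  fun_prop

lemma gridBump_nonneg (n : ℕ) (k : Fin m → ℕ) (x : unitCube m) : 0 ≤ gridBump n k x :=
  Finset.prod_nonneg fun _ _ => trapezoid_nonneg _ _

lemma gridBump_le_one (n : ℕ) (k : Fin m → ℕ) (x : unitCube m) : gridBump n k x ≤ 1 :=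
  Finset.prod_le_one (fun _ _ => trapezoid_nonneg _ _) fun _ _ => trapezoid_le_one _ _

lemma gridBump_eq_zero {n : ℕ} {k : Fin m → ℕ} {x : unitCube m} (h : k ≠ gridCell n x) :
    gridBump n k x = 0 := by
  obtain ⟨i, hi⟩ := Function.ne_iff.1 h
  refine Finset.prod_eq_zero (Finset.mem_univ i)
    (trapezoid_eq_zero (by positivity) fun hmem => hi ?_)
  refine ((Nat.floor_eq_iff (gridSize_mul_nonneg n x i)).2 ?_).symm
  constructor <;> linarith [hmem.1, hmem.2]

lemma gridBump_eq_one {n : ℕ} {x : unitCube m} (h : x ∈ gridCore m n) :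
    gridBump n (gridCell n x) x = 1 := by
  refine Finset.prod_eq_one fun i _ => trapezoid_eq_one (by positivity) ?_
  rw [← floor_add_fract_coord, add_sub_cancel_left]
  exact h i

/-- The contribution to the random map of the label `w` on the cell `k` of level `n + 1`. -/
noncomputable def layerTerm (n : ℕ) (k : Fin m → ℕ) (w : Label d) :
    C(unitCube m, EuclideanSpace ℝ (Fin d)) :=
  ⟨fun x => gridBump (n + 1) k x • ((1 / 4 : ℝ) ^ n • labelVec w), by fun_prop⟩

/-- The `n`-th layer of the random map: on the core of each cell of level `n + 1` it is constant,
equal to `4⁻ⁿ` times the label of the cell. -/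
noncomputable def layer (n : ℕ) (ω : ℕ × (Fin m → ℕ) → Label d) :
    C(unitCube m, EuclideanSpace ℝ (Fin d)) :=
  ∑ k ∈ gridIndices m (n + 1), layerTerm n k (ω (n, k))

lemma layer_apply (n : ℕ) (ω : ℕ × (Fin m → ℕ) → Label d) (x : unitCube m) :
    layer n ω x = if gridCell (n + 1) x ∈ gridIndices m (n + 1) then
      gridBump (n + 1) (gridCell (n + 1) x) x •
        ((1 / 4 : ℝ) ^ n • labelVec (ω (n, gridCell (n + 1) x))) else 0 := by
  classical
  rw [layer, ContinuousMap.sum_apply, ← Finset.sum_ite_eq' (gridIndices m (n + 1))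
    (gridCell (n + 1) x) fun k => gridBump (n + 1) k x • ((1 / 4 : ℝ) ^ n • labelVec (ω (n, k)))]
  refine Finset.sum_congr rfl fun k _ => ?_
  by_cases h : k = gridCell (n + 1) x
  · rw [if_pos h]; rfl
  · rw [if_neg h]
    change gridBump (n + 1) k x • ((1 / 4 : ℝ) ^ n • labelVec (ω (n, k))) = 0
    rw [gridBump_eq_zero h, zero_smul]

lemma layer_apply_of_mem_gridCore {n : ℕ} (ω : ℕ × (Fin m → ℕ) → Label d) {x : unitCube m}
    (hx : x ∈ gridCore m (n + 1)) :
    layer n ω x = (1 / 4 : ℝ) ^ n • labelVec (ω (n, gridCell (n + 1) x)) := by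
  rw [layer_apply, if_pos (gridCell_mem_gridIndices hx), gridBump_eq_one hx, one_smul]

lemma abs_layer_apply_le (n : ℕ) (ω : ℕ × (Fin m → ℕ) → Label d) (x : unitCube m) (i : Fin d) :
    |layer n ω x i| ≤ 8 * (1 / 4) ^ n := by
  rw [layer_apply]
  split_ifs with h
  · simp only [PiLp.smul_apply, smul_eq_mul, abs_mul]
    rw [abs_of_nonneg (gridBump_nonneg _ _ _), abs_of_pos (by positivity : (0 : ℝ) < (1 / 4) ^ n)]
    calc _ ≤ 1 * ((1 / 4 : ℝ) ^ n * 8) := by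
          gcongr
          · exact gridBump_le_one _ _ _
          · exact abs_labelVec_le _ _
      _ = _ := by ring
  · simp only [PiLp.zero_apply, abs_zero]; positivity

lemma norm_le_of_abs_apply_le {v : EuclideanSpace ℝ (Fin d)} {c : ℝ} (h : ∀ i, |v i| ≤ c) :
    ‖v‖ ≤ d * c := by
  calc ‖v‖ = ‖∑ i, EuclideanSpace.single i (v i)‖ := by
        congr 1
        ext j
        simp
    _ ≤ ∑ i : Fin d, ‖EuclideanSpace.single i (v i)‖ := norm_sum_le _ _
    _ ≤ ∑ _i : Fin d, c := Finset.sum_le_sum fun i _ => by simpa using h i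
    _ = _ := by simp

lemma norm_layer_le (n : ℕ) (ω : ℕ × (Fin m → ℕ) → Label d) :
    ‖layer n ω‖ ≤ d * (8 * (1 / 4) ^ n) :=
  (ContinuousMap.norm_le _ (by positivity)).2 fun x =>
    norm_le_of_abs_apply_le fun i => abs_layer_apply_le n ω x i

lemma summable_norm_bound (d : ℕ) : Summable fun n : ℕ => (d : ℝ) * (8 * (1 / 4) ^ n) :=
  ((summable_geometric_of_lt_one (by norm_num) (by norm_num)).mul_left _).mul_left _

lemma summable_layer (ω : ℕ × (Fin m → ℕ) → Label d) : Summable fun n => layer n ω :=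
  Summable.of_norm_bounded (summable_norm_bound d) fun n => norm_layer_le n ω

/-- The sum of all layers. -/
noncomputable def randomMap (ω : ℕ × (Fin m → ℕ) → Label d) :
    C(unitCube m, EuclideanSpace ℝ (Fin d)) :=
  ∑' n, layer n ω

lemma continuous_layer (n : ℕ) :
    Continuous fun ω : ℕ × (Fin m → ℕ) → Label d => layer n ω := by
  unfold layer
  exact continuous_finsetSum _ fun k _ =>
    (continuous_of_discreteTopology (f := layerTerm n k)).comp (continuous_apply (n, k))

lemma continuous_randomMap :
    Continuous (randomMap : (ℕ × (Fin m → ℕ) → Label d) → _) :=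
  continuous_tsum continuous_layer (summable_norm_bound d) fun n ω => norm_layer_le n ω

lemma measurable_randomMap [MeasurableSpace C(unitCube m, EuclideanSpace ℝ (Fin d))]
    [BorelSpace C(unitCube m, EuclideanSpace ℝ (Fin d))] :
    Measurable (randomMap : (ℕ × (Fin m → ℕ) → Label d) → _) :=
  continuous_randomMap.measurable

lemma abs_randomMap_sub_le (n : ℕ) (ω : ℕ × (Fin m → ℕ) → Label d) (x : unitCube m) (i : Fin d) :
    |randomMap ω x i - ∑ j ∈ Finset.range n, layer j ω x i| ≤ 32 / 3 * (1 / 4) ^ n := by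
  have hs : HasSum (fun j => layer j ω x i) (randomMap ω x i) := by
    have h1 := (summable_layer ω).hasSum
    have hc : Continuous fun f : C(unitCube m, EuclideanSpace ℝ (Fin d)) => f x i := by fun_prop
    exact h1.map (⟨⟨fun f : C(unitCube m, EuclideanSpace ℝ (Fin d)) => f x i, rfl⟩,
      fun _ _ => rfl⟩ : C(unitCube m, EuclideanSpace ℝ (Fin d)) →+ ℝ) hc
  have hg : HasSum (fun j : ℕ => 8 * (1 / 4 : ℝ) ^ (j + n)) (32 / 3 * (1 / 4) ^ n) := by
    have h := (hasSum_geometric_of_lt_one (r := (1 / 4 : ℝ)) (by norm_num) (by norm_num)).mul_left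
      (8 * (1 / 4 : ℝ) ^ n)
    have h1 : (fun j : ℕ => 8 * (1 / 4 : ℝ) ^ (j + n)) =
        fun j => 8 * (1 / 4 : ℝ) ^ n * (1 / 4) ^ j := by
      funext j; rw [pow_add]; ring
    have h2 : 32 / 3 * (1 / 4 : ℝ) ^ n = 8 * (1 / 4 : ℝ) ^ n * (1 - 1 / 4)⁻¹ := by
      norm_num; ring
    rw [h1, h2]
    exact h
  have ht := (hasSum_nat_add_iff' n).2 hs
  rw [← Real.norm_eq_abs, ← ht.tsum_eq]
  exact tsum_of_norm_bounded hg fun j => abs_layer_apply_le _ _ _ _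

lemma countable_range_sum_layer (n : ℕ) :
    (range fun ω : ℕ × (Fin m → ℕ) → Label d => ∑ j ∈ Finset.range n, layer j ω).Countable := by
  classical
  have hfac : ∀ j, (range fun ω : ℕ × (Fin m → ℕ) → Label d => layer j ω).Finite := fun j => by
    refine (finite_range fun η : gridIndices m (j + 1) → Label d =>
      ∑ k ∈ (gridIndices m (j + 1)).attach, layerTerm j k.1 (η k)).subset ?_
    rintro _ ⟨ω, rfl⟩
    exact ⟨fun k => ω (j, k.1), Finset.sum_attach _ fun k => layerTerm j k (ω (j, k))⟩
  refine Finite.countable ?_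
  induction n with
  | zero => simp
  | succ n ih =>
    refine (Finite.image2 (· + ·) ih (hfac n)).subset ?_
    rintro _ ⟨ω, rfl⟩
    exact ⟨_, ⟨ω, rfl⟩, _, ⟨ω, rfl⟩, (Finset.sum_range_succ _ _).symm⟩

end RandomMap

/-- The uniform distribution on labels. -/
noncomputable def labelMeasure (d : ℕ) : Measure (Label d) := uniformOn univ

instance (d : ℕ) : IsProbabilityMeasure (labelMeasure d) := by
  unfold labelMeasure; infer_instance

lemma labelMeasure_singleton {d : ℕ} (v : Label d) :
    labelMeasure d {v} = ENNReal.ofReal ((1 / 16) ^ d) := by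
  rw [labelMeasure, uniformOn_univ, Measure.count_singleton, Fintype.card_fun, Fintype.card_fin,
    Fintype.card_fin, one_div, one_div, inv_pow, ENNReal.ofReal_inv_of_pos (by positivity)]
  norm_num

/-- The law of the family of independent uniform labels. -/
noncomputable def labelsMeasure (m d : ℕ) : Measure (ℕ × (Fin m → ℕ) → Label d) :=
  Measure.infinitePi fun _ => labelMeasure d

instance (m d : ℕ) : IsProbabilityMeasure (labelsMeasure m d) := by
  unfold labelsMeasure; infer_instance

/-! ### Random hits on a pruned set -/

lemma eventually_mul_sq_le (a : ℝ) {ε : ℝ} (hε : 0 < ε) :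
    ∀ᶠ n : ℕ in atTop, a * ((n : ℝ) + 2) ^ 2 ≤ ε * 4 ^ n := by
  have h : Tendsto (fun n : ℕ => (9 * |a|) * ((n : ℝ) ^ 2 * (1 / 4) ^ n)) atTop (𝓝 0) := by
    simpa using (tendsto_pow_const_mul_const_pow_of_abs_lt_one 2
      (r := (1 / 4 : ℝ)) (by norm_num [abs_of_pos])).const_mul (9 * |a|)
  filter_upwards [h.eventually_lt_const hε, eventually_ge_atTop 1] with n hn h1
  have hn1 : (1 : ℝ) ≤ n := by exact_mod_cast h1
  have h4 : (0 : ℝ) < 4 ^ n := by positivity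
  have h5 : 9 * |a| * (n : ℝ) ^ 2 ≤ ε * 4 ^ n := by
    have := mul_le_mul_of_nonneg_right hn.le h4.le
    rw [one_div, inv_pow] at this
    calc _ = 9 * |a| * ((n : ℝ) ^ 2 * (4 ^ n)⁻¹) * 4 ^ n := by field_simp
      _ ≤ _ := this
  calc a * ((n : ℝ) + 2) ^ 2 ≤ |a| * ((n : ℝ) + 2) ^ 2 := by gcongr; exact le_abs_self a
    _ ≤ |a| * (3 * n) ^ 2 := by gcongr; linarith
    _ = 9 * |a| * (n : ℝ) ^ 2 := by ring
    _ ≤ _ := h5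

/-- The number of children selected in a cell of level `n`. The exponent loses only a linear term
in `n` against the total number `2 ^ (3 m 4ⁿ)` of children: `3 d n` for the threshold of pruning,
`4 d` for the probability `16 ^ (-d)` of a label, and `2` for the Chernoff bound. The subtraction is
truncated, so this is meaningful only for large `n`. -/
def branching (m d n : ℕ) : ℕ := 2 ^ (3 * m * 4 ^ n - (3 * d * n + 4 * d + 2))

lemma eventually_exponent_le {m : ℕ} (hm : 0 < m) (d : ℕ) :
    ∀ᶠ n₀ : ℕ in atTop, ∀ n, n₀ ≤ n → 3 * d * n + 4 * d + 2 ≤ 3 * m * 4 ^ n := by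
  refine (eventually_forall_ge_atTop.2 ?_ : ∀ᶠ n₀ : ℕ in atTop, ∀ n, n₀ ≤ n → _)
  filter_upwards [eventually_mul_sq_le (3 * d + 2) (ε := 3 * m) (by positivity)] with n hn
  have h : (3 * d * n + 4 * d + 2 : ℝ) ≤ 3 * m * 4 ^ n := by
    refine le_trans ?_ hn
    have hn0 : (0 : ℝ) ≤ n := by positivity
    have hd0 : (0 : ℝ) ≤ d := by positivity
    nlinarith [mul_nonneg hd0 hn0, mul_nonneg hd0 (mul_nonneg hn0 hn0), mul_nonneg hn0 hn0]
  exact_mod_cast h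

section Hits

variable {m d : ℕ}

/-- The index of the cube of side `4⁻ⁿ` containing `y`. -/
noncomputable def quantize (n : ℕ) (y : EuclideanSpace ℝ (Fin d)) : Fin d → ℤ :=
  fun i => ⌊(4 : ℝ) ^ n * y i⌋

lemma measurable_quantize (n : ℕ) : Measurable (quantize (d := d) n) :=
  measurable_pi_lambda _ fun i => Int.measurable_floor.comp
    ((by fun_prop : Measurable fun y : EuclideanSpace ℝ (Fin d) => (4 : ℝ) ^ n * y i))

lemma abs_sub_lt_of_quantize_eq {n : ℕ} {y z : EuclideanSpace ℝ (Fin d)}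
    (h : quantize n y = quantize n z) (i : Fin d) : |y i - z i| < (1 / 4) ^ n := by
  have h1 := Int.abs_sub_lt_one_of_floor_eq_floor (congrFun h i)
  rw [← mul_sub, abs_mul, abs_of_pos (by positivity : (0 : ℝ) < 4 ^ n)] at h1
  rw [one_div, inv_pow, ← one_div, lt_div_iff₀ (by positivity), mul_comm]
  exact h1

/-- The indices of the cubes of side `4⁻ⁿ` that cover `[-C, C]ᵈ`. -/
noncomputable def quantizeBox (d C n : ℕ) : Finset (Fin d → ℤ) :=
  Fintype.piFinset fun _ => Finset.Icc (-((C * 4 ^ n : ℕ) : ℤ)) ((C * 4 ^ n : ℕ) : ℤ)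

lemma quantize_mem_quantizeBox {C n : ℕ} {y : EuclideanSpace ℝ (Fin d)} (h : ∀ i, |y i| ≤ C) :
    quantize n y ∈ quantizeBox d C n := by
  refine Fintype.mem_piFinset.2 fun i => Finset.mem_Icc.2 ?_
  have h1 := abs_le.1 (h i)
  have h4 : (0 : ℝ) < 4 ^ n := by positivity
  constructor
  · refine Int.le_floor.2 ?_
    push_cast
    nlinarith
  · have : (quantize n y i : ℝ) ≤ C * 4 ^ n := (Int.floor_le _).trans (by nlinarith)
    exact_mod_cast this

lemma card_quantizeBox_le (d C n : ℕ) :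
    ((quantizeBox d C n).card : ℝ) ≤ (2 * C + 1) ^ d * 4 ^ (d * n) := by
  rw [quantizeBox, Fintype.card_piFinset]
  simp only [Int.card_Icc, Finset.prod_const, Finset.card_univ, Fintype.card_fin]
  rw [mul_comm d n, pow_mul, ← mul_pow]
  push_cast
  gcongr
  have h : (((C * 4 ^ n : ℕ) : ℤ) + 1 - -((C * 4 ^ n : ℕ) : ℤ)).toNat = 2 * (C * 4 ^ n) + 1 := by
    omega
  push_cast at h
  rw [h]
  have : (1 : ℝ) ≤ 4 ^ n := one_le_pow₀ (by norm_num)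
  push_cast
  linarith

/-- The measure lost by pruning at stage `n`, together with the measure outside the cores. -/
noncomputable def lossBound (m d C n : ℕ) : ℝ :=
  (2 * C + 1) ^ d * (1 / 2) ^ (d * n) + 2 * m * (1 / 4) ^ (n + 1)

lemma summable_lossBound {d : ℕ} (hd : 0 < d) (m C : ℕ) : Summable (lossBound m d C) := by
  refine Summable.add (Summable.mul_left _ ?_) (Summable.mul_left _ ?_)
  · simp only [pow_mul]
    exact summable_geometric_of_lt_one (by positivity)
      (pow_lt_one₀ (by norm_num) (by norm_num) hd.ne')
  · exact (summable_nat_add_iff 1).2 (summable_geometric_of_lt_one (by norm_num) (by norm_num))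

/-- The threshold below which a piece of a cell of level `n` is pruned. -/
noncomputable def pruneThreshold (m d n : ℕ) : ℝ :=
  (1 / 8) ^ (d * n) * ((gridSize n : ℝ) ^ m)⁻¹

/-- The set `S` lies in all cores from level `n₀ + 1` on, and it meets each of the pieces
`{gridCell n = I} ∩ {quantize n ∘ g = q}`, for `n ≥ n₀`, in either the empty set or a set of measure
at least `pruneThreshold m d n`. -/
def IsPruned (S : Set (unitCube m)) (g : unitCube m → EuclideanSpace ℝ (Fin d)) (n₀ : ℕ) : Prop :=
  (∀ x ∈ S, ∀ n, n₀ ≤ n → x ∈ gridCore m (n + 1)) ∧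
  ∀ x ∈ S, ∀ n, n₀ ≤ n → ENNReal.ofReal (pruneThreshold m d n) ≤
    volume {z | z ∈ S ∧ gridCell n z = gridCell n x ∧ quantize n (g z) = quantize n (g x)}

lemma gridCell_mem_gridIndices_of_succ {n : ℕ} {x : unitCube m} (hx : x ∈ gridCore m (n + 1)) :
    gridCell n x ∈ gridIndices m n := by
  refine Fintype.mem_piFinset.2 fun i => Finset.mem_range.2 ?_
  have h := Finset.mem_range.1 (Fintype.mem_piFinset.1 (gridCell_mem_gridIndices hx) i)
  rw [gridCell_eq_succ_div]
  refine Nat.div_lt_of_lt_mul ?_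
  rwa [gridSize_succ, mul_comm] at h

/-- Pruned sets of measure close to `1` exist: there are at most `(2 C + 1) ^ d * 4 ^ (d n)` values
of `q` at level `n`, so the thresholds sum up to at most `(2 C + 1) ^ d * 2 ^ (-d n)` at this
level. -/
lemma exists_isPruned {g : unitCube m → EuclideanSpace ℝ (Fin d)}
    (hg : Measurable g) {C : ℕ} (hC : ∀ x i, |g x i| ≤ C) (n₀ : ℕ) :
    ∃ S : Set (unitCube m), MeasurableSet S ∧ IsPruned S g n₀ ∧
      volume Sᶜ ≤ ∑' k, ENNReal.ofReal (lossBound m d C (k + n₀)) := by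
  let X₀ : Set (unitCube m) := ⋂ k, gridCore m (k + n₀ + 1)
  have hX₀ : MeasurableSet X₀ := MeasurableSet.iInter fun k => measurableSet_gridCore _
  let ι := Σ k : ℕ, (gridIndices m (k + n₀) × quantizeBox d C (k + n₀) : Type)
  let E : ι → Set (unitCube m) := fun i =>
    gridCell (i.1 + n₀) ⁻¹' {i.2.1.1} ∩ (fun z => quantize (i.1 + n₀) (g z)) ⁻¹' {i.2.2.1}
  have hE : ∀ i, MeasurableSet (E i) := fun i =>
    (measurable_gridCell _ (measurableSet_singleton _)).inter
      (((measurable_quantize _).comp hg) (measurableSet_singleton _))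
  obtain ⟨S, hSX, hSm, hSvol, hS⟩ := exists_pruned_set (volume : Measure (unitCube m)) hX₀ hE
    fun i => ENNReal.ofReal (pruneThreshold m d (i.1 + n₀))
  have hcore : ∀ x ∈ S, ∀ n, n₀ ≤ n → x ∈ gridCore m (n + 1) := by
    intro x hx n hn
    have := mem_iInter.1 (hSX hx) (n - n₀)
    rwa [Nat.sub_add_cancel hn] at this
  refine ⟨S, hSm, ⟨hcore, fun x hx n hn => ?_⟩, ?_⟩
  · obtain ⟨k, rfl⟩ := Nat.exists_eq_add_of_le' hn
    have h := hS ⟨k, ⟨gridCell (k + n₀) x, gridCell_mem_gridIndices_of_succ (hcore x hx _ hn)⟩,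
      ⟨quantize (k + n₀) (g x), quantize_mem_quantizeBox (hC x)⟩⟩ ⟨x, hx, rfl, rfl⟩
    exact h
  · have h1 : volume X₀ᶜ ≤ ∑' k, ENNReal.ofReal (2 * m * (1 / 4) ^ (k + n₀ + 1)) := by
      rw [compl_iInter]
      exact (measure_iUnion_le _).trans
        (ENNReal.tsum_le_tsum fun k => volume_gridCore_compl_le (by omega))
    have h2 : ∑' i : ι, ENNReal.ofReal (pruneThreshold m d (i.1 + n₀)) ≤
        ∑' k, ENNReal.ofReal ((2 * C + 1) ^ d * (1 / 2) ^ (d * (k + n₀))) := by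
      refine (ENNReal.tsum_sigma' fun i : ι =>
        ENNReal.ofReal (pruneThreshold m d (i.1 + n₀))).trans_le ?_
      refine ENNReal.tsum_le_tsum fun k => ?_
      rw [tsum_fintype]
      dsimp only
      rw [Finset.sum_const, nsmul_eq_mul, Finset.card_univ, Fintype.card_prod,
        Fintype.card_coe, Fintype.card_coe, ← ENNReal.ofReal_natCast,
        ← ENNReal.ofReal_mul (by positivity)]
      refine ENNReal.ofReal_le_ofReal ?_
      rw [card_gridIndices, pruneThreshold]
      push_cast
      have hD : (0 : ℝ) < (gridSize (k + n₀) : ℝ) ^ m := pow_pos (gridSize_cast_pos _) m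
      have hpow : (4 : ℝ) ^ (d * (k + n₀)) * (1 / 8) ^ (d * (k + n₀)) =
          (1 / 2) ^ (d * (k + n₀)) := by
        rw [← mul_pow]; norm_num
      calc (gridSize (k + n₀) : ℝ) ^ m * ((quantizeBox d C (k + n₀)).card : ℝ) *
            ((1 / 8) ^ (d * (k + n₀)) * ((gridSize (k + n₀) : ℝ) ^ m)⁻¹)
          = ((quantizeBox d C (k + n₀)).card : ℝ) * (1 / 8) ^ (d * (k + n₀)) := by field_simp
        _ ≤ ((2 * C + 1) ^ d * 4 ^ (d * (k + n₀))) * (1 / 8) ^ (d * (k + n₀)) := by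
            gcongr; exact card_quantizeBox_le _ _ _
        _ = _ := by rw [mul_assoc, hpow]
    calc volume Sᶜ ≤ volume (X₀ᶜ ∪ X₀ \ S) := by
          refine measure_mono fun x hx => ?_
          by_cases h : x ∈ X₀
          · exact Or.inr ⟨h, hx⟩
          · exact Or.inl h
      _ ≤ volume X₀ᶜ + volume (X₀ \ S) := measure_union_le _ _
      _ ≤ _ := add_le_add h1 (hSvol.trans h2)
      _ = _ := by
          rw [← ENNReal.tsum_add]
          refine tsum_congr fun k => ?_
          rw [← ENNReal.ofReal_add (by positivity) (by positivity), add_comm]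
          rfl

/-- At every stage `n ≥ n₁` and near every point of `S` each label is attained in `branching m d n`
children, at points of `S` at which `g` takes nearly the same value. -/
def HasHits (S : Set (unitCube m)) (g : unitCube m → EuclideanSpace ℝ (Fin d))
    (ω : ℕ × (Fin m → ℕ) → Label d) (n₁ : ℕ) : Prop :=
  ∀ n, n₁ ≤ n → ∀ x ∈ S, ∀ v, ∃ P : Finset (unitCube m), P.card = branching m d n ∧
    (∀ p ∈ P, p ∈ S ∧ gridCell n p = gridCell n x ∧ (∀ i, |g p i - g x i| < (1 / 4) ^ n) ∧
      ω (n, gridCell (n + 1) p) = v) ∧ Set.InjOn (gridCell (n + 1)) (P : Set (unitCube m))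

open Classical in
/-- The children of the cell `I` of level `n` that meet the piece of `S` given by `a = (I, q)`. -/
noncomputable def meetingChildren (S : Set (unitCube m))
    (g : unitCube m → EuclideanSpace ℝ (Fin d)) (n : ℕ) (a : (Fin m → ℕ) × (Fin d → ℤ)) :
    Finset (Fin m → ℕ) :=
  (gridIndices m (n + 1)).filter fun J =>
    ∃ z ∈ S, gridCell n z = a.1 ∧ quantize n (g z) = a.2 ∧ gridCell (n + 1) z = J

/-- Pieces that are not pruned are spread over many children, as each child has measure at most
`gridSize (n + 1) ^ (-m)`. -/
lemma IsPruned.card_meetingChildren_ge {S : Set (unitCube m)}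
    {g : unitCube m → EuclideanSpace ℝ (Fin d)} {n₀ : ℕ} (hS : IsPruned S g n₀) {n : ℕ}
    (hn : n₀ ≤ n) {x : unitCube m} (hx : x ∈ S) :
    (1 / 8 : ℝ) ^ (d * n) * 2 ^ (3 * m * 4 ^ n) ≤
      (meetingChildren S g n (gridCell n x, quantize n (g x))).card := by
  classical
  set T := meetingChildren S g n (gridCell n x, quantize n (g x)) with hT
  have h1 := hS.2 x hx n hn
  have h2 : {z | z ∈ S ∧ gridCell n z = gridCell n x ∧ quantize n (g z) = quantize n (g x)} ⊆
      ⋃ J ∈ T, gridCell (n + 1) ⁻¹' {J} := by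
    rintro z ⟨hz, hz1, hz2⟩
    refine mem_iUnion₂.2 ⟨gridCell (n + 1) z, ?_, rfl⟩
    rw [hT, meetingChildren]
    exact Finset.mem_filter.2 ⟨gridCell_mem_gridIndices (hS.1 z hz n hn), z, hz, hz1, hz2, rfl⟩
  have h3 := calc
    ENNReal.ofReal (pruneThreshold m d n) ≤
        volume (⋃ J ∈ T, gridCell (n + 1) ⁻¹' {J} : Set (unitCube m)) :=
        h1.trans (measure_mono h2)
    _ ≤ ∑ J ∈ T, volume (gridCell (n + 1) ⁻¹' {J} : Set (unitCube m)) :=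
        measure_biUnion_finset_le _ _
    _ ≤ ∑ _J ∈ T, ENNReal.ofReal (((gridSize (n + 1) : ℝ) ^ m)⁻¹) :=
        Finset.sum_le_sum fun J _ => volume_gridCell_preimage_le _ _
    _ = ENNReal.ofReal (T.card * ((gridSize (n + 1) : ℝ) ^ m)⁻¹) := by
        rw [Finset.sum_const, nsmul_eq_mul, ← ENNReal.ofReal_natCast,
          ← ENNReal.ofReal_mul (by positivity)]
  have hD : (0 : ℝ) < (gridSize n : ℝ) ^ m := pow_pos (gridSize_cast_pos _) m
  rw [ENNReal.ofReal_le_ofReal_iff (by positivity), pruneThreshold, gridSize_succ] at h3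
  push_cast at h3
  have h2pos : (0 : ℝ) < (2 ^ (3 * 4 ^ n)) ^ m := by positivity
  rw [mul_pow, mul_inv, ← div_eq_mul_inv, div_le_iff₀ hD, mul_assoc, mul_right_comm,
    inv_mul_cancel₀ hD.ne', one_mul, ← div_eq_mul_inv, le_div_iff₀ h2pos] at h3
  calc _ = (1 / 8 : ℝ) ^ (d * n) * (2 ^ (3 * 4 ^ n)) ^ m := by
        rw [← pow_mul]; congr 2; ring
    _ ≤ _ := h3

lemma summable_card_div (hm : 0 < m) (K : ℝ) (hK : 0 ≤ K) :
    Summable fun n : ℕ => ((gridSize n : ℝ) ^ m * (K * 4 ^ (d * n))) /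
      ((1 / 16) ^ d * ((1 / 8) ^ (d * n) * 2 ^ (3 * m * 4 ^ n))) := by
  have hgeo : Summable fun n : ℕ => K * 16 ^ d * (1 / 2 : ℝ) ^ n :=
    (summable_geometric_of_lt_one (by norm_num) (by norm_num)).mul_left _
  refine Summable.of_norm_bounded_eventually_nat hgeo ?_
  filter_upwards [eventually_mul_sq_le (5 * d + 1) (ε := 2 * m) (by positivity)] with n hn
  have hexp : 5 * (d * n) + n ≤ 2 * m * 4 ^ n := by
    have h : (5 * (d * n) + n : ℝ) ≤ 2 * m * 4 ^ n := by
      refine le_trans ?_ hn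
      have hn0 : (0 : ℝ) ≤ n := by positivity
      have hd0 : (0 : ℝ) ≤ d := by positivity
      nlinarith [mul_nonneg hd0 hn0, mul_nonneg hd0 (mul_nonneg hn0 hn0), mul_nonneg hn0 hn0]
    exact_mod_cast h
  rw [Real.norm_of_nonneg (by positivity), div_le_iff₀ (by positivity)]
  have h8 : (8 : ℝ) ^ (d * n) = 2 ^ (3 * (d * n)) := by
    rw [show (8 : ℝ) = 2 ^ 3 by norm_num, ← pow_mul]
  have h4 : (4 : ℝ) ^ (d * n) = 2 ^ (2 * (d * n)) := by
    rw [show (4 : ℝ) = 2 ^ 2 by norm_num, ← pow_mul]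
  have hD : (gridSize n : ℝ) ^ m = 2 ^ (m * 4 ^ n) := by
    rw [gridSize]; push_cast; rw [← pow_mul, mul_comm]
  have h16 : (16 : ℝ) ^ d * (1 / 16) ^ d = 1 := by rw [← mul_pow]; norm_num
  have key : (2 : ℝ) ^ (m * 4 ^ n) * 2 ^ (2 * (d * n)) * 2 ^ (3 * (d * n)) * 2 ^ n ≤
      2 ^ (3 * m * 4 ^ n) := by
    rw [← pow_add, ← pow_add, ← pow_add]
    refine pow_le_pow_right₀ (by norm_num) ?_
    have : 3 * m * 4 ^ n = m * 4 ^ n + 2 * m * 4 ^ n := by ring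
    omega
  rw [hD, h4]
  have e1 : ((1 / 2 : ℝ)) ^ n * 2 ^ n = 1 := by rw [← mul_pow]; norm_num
  have e2 : ((1 / 8 : ℝ)) ^ (d * n) * 2 ^ (3 * (d * n)) = 1 := by
    rw [← h8, ← mul_pow]; norm_num
  have hpos : (0 : ℝ) ≤ K * ((1 / 2) ^ n * (1 / 8) ^ (d * n)) := by positivity
  calc (2 : ℝ) ^ (m * 4 ^ n) * (K * 2 ^ (2 * (d * n)))
      = (2 ^ (m * 4 ^ n) * (K * 2 ^ (2 * (d * n)))) *
          (((1 / 2 : ℝ)) ^ n * 2 ^ n) * (((1 / 8 : ℝ)) ^ (d * n) * 2 ^ (3 * (d * n))) := by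
        rw [e1, e2]; ring
    _ = K * ((1 / 2) ^ n * (1 / 8) ^ (d * n)) *
        (2 ^ (m * 4 ^ n) * 2 ^ (2 * (d * n)) * 2 ^ (3 * (d * n)) * 2 ^ n) := by ring
    _ ≤ K * ((1 / 2) ^ n * (1 / 8) ^ (d * n)) * 2 ^ (3 * m * 4 ^ n) := by gcongr
    _ = K * (16 ^ d * (1 / 16) ^ d) * ((1 / 2) ^ n * (1 / 8) ^ (d * n)) * 2 ^ (3 * m * 4 ^ n) := by
        rw [h16, mul_one]
    _ = _ := by ring

lemma IsPruned.ae_exists_hasHits (hm : 0 < m) {S : Set (unitCube m)}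
    {g : unitCube m → EuclideanSpace ℝ (Fin d)} {C : ℕ} (hC : ∀ x i, |g x i| ≤ C) {n₀ : ℕ}
    (hn₀ : ∀ n, n₀ ≤ n → 3 * d * n + 4 * d + 2 ≤ 3 * m * 4 ^ n) (hS : IsPruned S g n₀) :
    ∀ᵐ ω ∂labelsMeasure m d, ∃ n₁, n₀ ≤ n₁ ∧ HasHits S g ω n₁ := by
  classical
  let A : ℕ → Finset ((Fin m → ℕ) × (Fin d → ℤ)) := fun n =>
    (gridIndices m n ×ˢ quantizeBox d C n).filter fun a =>
      ∃ x ∈ S, a = (gridCell n x, quantize n (g x))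
  let b : ℕ → ℝ := fun n => (1 / 16) ^ d * ((1 / 8) ^ (d * n) * 2 ^ (3 * m * 4 ^ n))
  have hb : ∀ n, 0 < b n := fun n => by positivity
  have hcardA : ∀ n, ((A n).card : ℝ) ≤
      (gridSize n : ℝ) ^ m * ((2 * C + 1) ^ d * 4 ^ (d * n)) := by
    intro n
    calc ((A n).card : ℝ) ≤ ((gridIndices m n ×ˢ quantizeBox d C n).card : ℝ) := by
          exact_mod_cast Finset.card_filter_le _ _
      _ = (gridSize n : ℝ) ^ m * (quantizeBox d C n).card := by
          rw [Finset.card_product, card_gridIndices]; push_cast; rfl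
      _ ≤ _ := by gcongr; exact card_quantizeBox_le _ _ _
  have hsum : Summable fun n => ((A n).card : ℝ) / b n :=
    Summable.of_nonneg_of_le (fun n => div_nonneg (by positivity) (hb n).le)
      (fun n => div_le_div_of_nonneg_right (hcardA n) (hb n).le)
      (summable_card_div (d := d) hm ((2 * C + 1) ^ d) (by positivity))
  have hL : ∀ n, n₀ ≤ n → 4 * (branching m d n : ℝ) ≤ b n := by
    intro n hn
    have h8 : (8 : ℝ) ^ (d * n) = 2 ^ (3 * d * n) := by
      rw [show (8 : ℝ) = 2 ^ 3 by norm_num, ← pow_mul, mul_assoc]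
    have h16 : (16 : ℝ) ^ d = 2 ^ (4 * d) := by rw [pow_mul]; norm_num
    simp only [b, one_div, inv_pow, branching]
    rw [h8, h16]
    push_cast
    rw [← mul_assoc, ← mul_inv, ← pow_add, inv_mul_eq_div, le_div_iff₀ (by positivity),
      show (4 : ℝ) = 2 ^ 2 by norm_num, ← pow_add, ← pow_add]
    refine pow_le_pow_right₀ (by norm_num) ?_
    have := hn₀ n hn
    omega
  have hmain := ae_eventually_card_label_ge (p := (1 / 16) ^ d) (by positivity)
    (labelMeasure_singleton (d := d)) A (meetingChildren S g) (branching m d) b n₀ hb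
    (fun n hn a ha => by
      obtain ⟨-, x, hx, rfl⟩ := Finset.mem_filter.1 ha
      exact mul_le_mul_of_nonneg_left (hS.card_meetingChildren_ge hn hx) (by positivity))
    hL hsum
  filter_upwards [hmain] with ω hω
  obtain ⟨n₁, hn₁, h⟩ := hω
  refine ⟨n₁, hn₁, fun n hn x hx v => ?_⟩
  have hn' := hn₁.trans hn
  have ha : (gridCell n x, quantize n (g x)) ∈ A n := Finset.mem_filter.2
    ⟨Finset.mem_product.2 ⟨gridCell_mem_gridIndices_of_succ (hS.1 x hx n hn'),
      quantize_mem_quantizeBox (hC x)⟩, x, hx, rfl⟩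
  obtain ⟨F, hFsub, hFcard⟩ := Finset.exists_subset_card_eq (h n hn _ ha v)
  have hpt : ∀ J ∈ F, ∃ z ∈ S, gridCell n z = gridCell n x ∧ quantize n (g z) = quantize n (g x) ∧
      gridCell (n + 1) z = J ∧ ω (n, J) = v := by
    intro J hJ
    obtain ⟨hJ1, hJ2⟩ := Finset.mem_filter.1 (hFsub hJ)
    obtain ⟨-, z, hz, h1, h2, h3⟩ := Finset.mem_filter.1 hJ1
    exact ⟨z, hz, h1, h2, h3, hJ2⟩
  have : Nonempty (unitCube m) := ⟨x⟩
  choose! z hzS hz1 hz2 hz3 hz4 using hpt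
  have hinj : Set.InjOn z F := fun J hJ J' hJ' hJJ => by
    rw [← hz3 J hJ, ← hz3 J' hJ', hJJ]
  refine ⟨F.image z, ?_, ?_, ?_⟩
  · rw [Finset.card_image_of_injOn hinj, hFcard]
  · intro p hp
    obtain ⟨J, hJ, rfl⟩ := Finset.mem_image.1 hp
    refine ⟨hzS J hJ, hz1 J hJ, abs_sub_lt_of_quantize_eq (hz2 J hJ), ?_⟩
    rw [hz3 J hJ, hz4 J hJ]
  · intro p hp p' hp' hpp
    obtain ⟨J, hJ, rfl⟩ := Finset.mem_image.1 (Finset.mem_coe.1 hp)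
    obtain ⟨J', hJ', rfl⟩ := Finset.mem_image.1 (Finset.mem_coe.1 hp')
    rw [hz3 J hJ, hz3 J' hJ'] at hpp
    rw [hpp]

end Hits

/-! ### Dimension of the fibers over hit targets -/

section Fibers

variable {m d : ℕ}

lemma gridCell_eq_of_le {n : ℕ} {x y : unitCube m} (h : gridCell n x = gridCell n y) {j : ℕ}
    (hj : j ≤ n) : gridCell j x = gridCell j y := by
  induction n, hj using Nat.le_induction with
  | base => exact h
  | succ n _ ih => exact ih (gridCell_eq_of_succ_eq n x y h)

lemma gridSize_pow_le_prod_branching {k : ℕ}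
    (hexp : ∀ n, k ≤ n → 3 * d * n + 4 * d + 2 ≤ 3 * m * 4 ^ n) {l : ℕ} (hl : k ≤ l) :
    gridSize l ^ m ≤ gridSize k ^ m * (∏ j ∈ Finset.Ico k l, branching m d j) *
      2 ^ ((2 * d + 1) * (l + 1) ^ 2) := by
  induction l, hl using Nat.le_induction with
  | base => simpa using Nat.le_mul_of_pos_right (gridSize k ^ m) (by positivity)
  | succ l hl ih =>
    have hb : (2 ^ (3 * 4 ^ l)) ^ m = branching m d l * 2 ^ (3 * d * l + 4 * d + 2) := by
      rw [branching, ← pow_add, Nat.sub_add_cancel (hexp l hl), ← pow_mul]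
      congr 1; ring
    rw [gridSize_succ, mul_pow, hb, Finset.prod_Ico_succ_top hl]
    calc gridSize l ^ m * (branching m d l * 2 ^ (3 * d * l + 4 * d + 2))
        ≤ (gridSize k ^ m * (∏ j ∈ Finset.Ico k l, branching m d j) *
          2 ^ ((2 * d + 1) * (l + 1) ^ 2)) * (branching m d l * 2 ^ (3 * d * l + 4 * d + 2)) := by
          gcongr
      _ = gridSize k ^ m * ((∏ j ∈ Finset.Ico k l, branching m d j) * branching m d l) *
          2 ^ ((2 * d + 1) * (l + 1) ^ 2 + (3 * d * l + 4 * d + 2)) := by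
          rw [pow_add]; ring
      _ ≤ _ := by
          gcongr
          · norm_num
          · nlinarith

lemma exists_bound_two_pow_sq {a ε : ℝ} (hε : 0 < ε) :
    ∃ K : ℝ, 0 < K ∧ ∀ l : ℕ, (2 : ℝ) ^ (a * ((l : ℝ) + 2) ^ 2 - ε * 4 ^ l) ≤ K := by
  obtain ⟨N, hN⟩ := eventually_atTop.1 (eventually_mul_sq_le a hε)
  refine ⟨1 + ∑ l ∈ Finset.range N, (2 : ℝ) ^ (a * ((l : ℝ) + 2) ^ 2 - ε * 4 ^ l), ?_, fun l => ?_⟩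
  · have : 0 ≤ ∑ l ∈ Finset.range N, (2 : ℝ) ^ (a * ((l : ℝ) + 2) ^ 2 - ε * 4 ^ l) :=
      Finset.sum_nonneg fun l _ => by positivity
    linarith
  · rcases lt_or_ge l N with h | h
    · have := Finset.single_le_sum
        (f := fun l : ℕ => (2 : ℝ) ^ (a * ((l : ℝ) + 2) ^ 2 - ε * 4 ^ l))
        (fun l _ => by positivity) (Finset.mem_range.2 h)
      linarith
    · have h1 : (2 : ℝ) ^ (a * ((l : ℝ) + 2) ^ 2 - ε * 4 ^ l) ≤ 1 :=
        Real.rpow_le_one_of_one_le_of_nonpos (by norm_num) (by linarith [hN l h])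
      have : 0 ≤ ∑ l ∈ Finset.range N, (2 : ℝ) ^ (a * ((l : ℝ) + 2) ^ 2 - ε * 4 ^ l) :=
        Finset.sum_nonneg fun l _ => by positivity
      linarith

/-- A point set that is spread over the grid cells like the selected points of the tree satisfies a
Frostman-type bound with every exponent `s < m`: the factor `2 ^ O(l²)` lost in the first `l` steps
is negligible against the side `2 ^ (-4 ^ l)` of the cells. -/
lemma exists_card_le_mul_rpow {k : ℕ}
    (hexp : ∀ n, k ≤ n → 3 * d * n + 4 * d + 2 ≤ 3 * m * 4 ^ n) {s : ℝ} (hs : 0 < s)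
    (hsm : s < m) : ∃ C : ℝ, 0 < C ∧ ∀ N, ∀ P : Finset (unitCube m),
      P.card = ∏ j ∈ Finset.Ico k (k + N), branching m d j →
      (∀ l, k ≤ l → l ≤ k + N → ∀ J, (P.filter fun p => gridCell l p = J).card ≤
        ∏ j ∈ Finset.Ico l (k + N), branching m d j) →
      ∀ u : ℝ, (gridSize (k + N) : ℝ)⁻¹ ≤ u → ∀ U : Finset (unitCube m), U ⊆ P →
        (∀ p ∈ U, ∀ q ∈ U, dist p q ≤ u) → (U.card : ℝ) ≤ C * u ^ s * P.card := by
  classical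
  obtain ⟨K, hK0, hK⟩ := exists_bound_two_pow_sq (a := 2 * d + 1) (sub_pos.2 hsm)
  have hDk := gridSize_cast_pos k
  refine ⟨(gridSize k : ℝ) ^ s + 4 ^ m * (gridSize k : ℝ) ^ m * K, by positivity, ?_⟩
  intro N P hPcard hPcell u hu U hUP hU
  have hu0 : 0 < u := lt_of_lt_of_le (inv_pos.2 (gridSize_cast_pos _)) hu
  have hus : 0 < u ^ s := Real.rpow_pos_of_pos hu0 s
  have hP0 : (0 : ℝ) ≤ P.card := by positivity
  have huN : 1 ≤ u * gridSize (k + N) := by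
    rwa [inv_eq_one_div, div_le_iff₀ (gridSize_cast_pos _)] at hu
  by_cases huk : 1 ≤ u * gridSize k
  · have h1 : 1 ≤ (gridSize k : ℝ) ^ s * u ^ s := by
      rw [← Real.mul_rpow hDk.le hu0.le, mul_comm]
      exact Real.one_le_rpow huk hs.le
    calc (U.card : ℝ) ≤ P.card := by exact_mod_cast Finset.card_le_card hUP
      _ ≤ ((gridSize k : ℝ) ^ s * u ^ s) * P.card := le_mul_of_one_le_left hP0 h1
      _ ≤ _ := by
        gcongr
        exact le_add_of_nonneg_right (by positivity)
  · -- `l + 1` is the first level whose cells are smaller than `u`.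
    have hex : ∃ l, 1 ≤ u * gridSize l := ⟨_, huN⟩
    obtain ⟨l, hl⟩ : ∃ l, Nat.find hex = l + 1 := by
      refine Nat.exists_eq_succ_of_ne_zero fun h0 => huk ?_
      have h1 := Nat.find_spec hex
      rw [h0] at h1
      refine h1.trans ?_
      gcongr
      exact gridSize_mono (Nat.zero_le k)
    have hl1 : 1 ≤ u * gridSize (l + 1) := hl ▸ Nat.find_spec hex
    have hl0 : u * gridSize l < 1 := not_le.1 (Nat.find_min hex (by omega))
    have hlN : l + 1 ≤ k + N := hl ▸ Nat.find_min' hex huN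
    have hkl : k ≤ l + 1 := by
      by_contra hc
      refine huk (hl1.trans ?_)
      gcongr
      exact gridSize_mono (by omega)
    set B := ∏ j ∈ Finset.Ico k (l + 1), branching m d j with hB
    set R := ∏ j ∈ Finset.Ico (l + 1) (k + N), branching m d j with hR
    have hPBR : (P.card : ℝ) = B * R := by
      rw [hPcard, ← Finset.prod_Ico_consecutive _ hkl hlN, ← hB, ← hR, Nat.cast_mul]
    have h1 : (U.card : ℝ) ≤ R * (4 * (u * gridSize (l + 1))) ^ m := by
      calc (U.card : ℝ) ≤ R * (U.image (gridCell (l + 1))).card := by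
            exact_mod_cast Finset.card_le_mul_card_image U R fun J _ =>
              (Finset.card_le_card (Finset.filter_subset_filter _ hUP)).trans
                (hPcell (l + 1) hkl hlN J)
        _ ≤ _ := by gcongr; exact card_image_gridCell_le hl1 U hU
    have h2 : (gridSize (l + 1) : ℝ) ^ m ≤
        (gridSize k : ℝ) ^ m * B * 2 ^ ((2 * d + 1) * (l + 1 + 1) ^ 2) := by
      exact_mod_cast gridSize_pow_le_prod_branching hexp hkl
    have h3 : u ^ m * 2 ^ ((2 * d + 1) * (l + 1 + 1) ^ 2) ≤ u ^ s * K := by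
      have hDl := gridSize_cast_pos l
      have e1 : u ^ m = u ^ s * u ^ ((m : ℝ) - s) := by
        rw [← Real.rpow_add hu0, ← Real.rpow_natCast]; congr 1; ring
      have e2 : u ^ ((m : ℝ) - s) ≤ (2 : ℝ) ^ (-(((m : ℝ) - s) * 4 ^ l)) := by
        have hul : u ≤ (2 : ℝ) ^ (-(4 ^ l : ℝ)) := by
          have : (gridSize l : ℝ) = (2 : ℝ) ^ (4 ^ l : ℝ) := by
            rw [gridSize]; push_cast
            rw [← Real.rpow_natCast]; push_cast; rfl
          rw [Real.rpow_neg (by norm_num), ← this, inv_eq_one_div, le_div_iff₀ hDl]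
          exact hl0.le
        calc u ^ ((m : ℝ) - s) ≤ ((2 : ℝ) ^ (-(4 ^ l : ℝ))) ^ ((m : ℝ) - s) :=
              Real.rpow_le_rpow hu0.le hul (by linarith)
          _ = _ := by rw [← Real.rpow_mul (by norm_num)]; congr 1; ring
      have e3 : (2 : ℝ) ^ ((2 * d + 1) * (l + 1 + 1) ^ 2) =
          (2 : ℝ) ^ ((2 * (d : ℝ) + 1) * ((l : ℝ) + 2) ^ 2) := by
        rw [← Real.rpow_natCast]; push_cast; congr 1; ring
      rw [e1, e3, mul_assoc]
      gcongr
      calc _ ≤ (2 : ℝ) ^ (-(((m : ℝ) - s) * 4 ^ l)) *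
            (2 : ℝ) ^ ((2 * (d : ℝ) + 1) * ((l : ℝ) + 2) ^ 2) := by gcongr
        _ = (2 : ℝ) ^ ((2 * (d : ℝ) + 1) * ((l : ℝ) + 2) ^ 2 - ((m : ℝ) - s) * 4 ^ l) := by
          rw [← Real.rpow_add (by norm_num)]; congr 1; ring
        _ ≤ K := hK l
    calc (U.card : ℝ) ≤ R * (4 * (u * gridSize (l + 1))) ^ m := h1
      _ = R * 4 ^ m * u ^ m * (gridSize (l + 1) : ℝ) ^ m := by rw [mul_pow, mul_pow]; ring
      _ ≤ R * 4 ^ m * u ^ m *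
          ((gridSize k : ℝ) ^ m * B * 2 ^ ((2 * d + 1) * (l + 1 + 1) ^ 2)) := by gcongr
      _ = 4 ^ m * (gridSize k : ℝ) ^ m * (u ^ m * 2 ^ ((2 * d + 1) * (l + 1 + 1) ^ 2)) *
          (B * R) := by ring
      _ ≤ 4 ^ m * (gridSize k : ℝ) ^ m * (u ^ s * K) * (B * R) := by gcongr
      _ = (4 ^ m * (gridSize k : ℝ) ^ m * K) * u ^ s * P.card := by rw [hPBR]; ring
      _ ≤ _ := by
        gcongr
        exact le_add_of_nonneg_left (by positivity)

/-- The sum of `g` and the layers from `n₀` to `n - 1`, at the point `x`. -/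
noncomputable def partialMap (g : unitCube m → EuclideanSpace ℝ (Fin d))
    (ω : ℕ × (Fin m → ℕ) → Label d) (n₀ n : ℕ) (x : unitCube m) (i : Fin d) : ℝ :=
  g x i + ∑ j ∈ Finset.Ico n₀ n, layer j ω x i

/-- The target `y` is within reach of the layers from `n` on, starting from the point `x`. -/
def IsReachable (g : unitCube m → EuclideanSpace ℝ (Fin d)) (ω : ℕ × (Fin m → ℕ) → Label d)
    (n₀ n : ℕ) (x : unitCube m) (y : EuclideanSpace ℝ (Fin d)) : Prop :=
  ∀ i, y i - partialMap g ω n₀ n x i ∈ Ico (-8 * (1 / 4 : ℝ) ^ n) (8 * (1 / 4) ^ n)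

/-- One step of the construction of the tree of approximate preimages: the label of the child is the
target residual rounded down to a multiple of `4⁻ⁿ`, which leaves a residual in `[0, 4⁻ⁿ)`, and the
oscillation of `g` adds at most `4⁻ⁿ`, while the next layer reaches up to `8 * 4⁻⁽ⁿ⁺¹⁾`. -/
lemma HasHits.exists_children {S : Set (unitCube m)} {g : unitCube m → EuclideanSpace ℝ (Fin d)}
    {n₀ n₁ : ℕ} {ω : ℕ × (Fin m → ℕ) → Label d} (hS : IsPruned S g n₀) (hn₁ : n₀ ≤ n₁)
    (hits : HasHits S g ω n₁) {n : ℕ} (hn : n₁ ≤ n) {x : unitCube m} (hx : x ∈ S)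
    {y : EuclideanSpace ℝ (Fin d)} (hy : IsReachable g ω n₀ n x y) :
    ∃ P : Finset (unitCube m), P.card = branching m d n ∧
      (∀ p ∈ P, (p ∈ S ∧ IsReachable g ω n₀ (n + 1) p y) ∧ gridCell n p = gridCell n x) ∧
      Set.InjOn (gridCell (n + 1)) (P : Set (unitCube m)) := by
  have ht : (0 : ℝ) < (1 / 4) ^ n := by positivity
  obtain ⟨v, hv⟩ := exists_label_sub_mem_Ico
    (r := fun i => (y i - partialMap g ω n₀ n x i) / (1 / 4) ^ n) fun i => by
      have := hy i
      rw [mem_Ico, le_div_iff₀ ht, div_lt_iff₀ ht]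
      exact this
  obtain ⟨P, hPcard, hP, hinj⟩ := hits n hn x hx v
  refine ⟨P, hPcard, fun p hp => ?_, hinj⟩
  obtain ⟨hpS, hpc, hpg, hpv⟩ := hP p hp
  refine ⟨⟨hpS, fun i => ?_⟩, hpc⟩
  have hn₀ : n₀ ≤ n := hn₁.trans hn
  have hsum : ∑ j ∈ Finset.Ico n₀ n, layer j ω p i = ∑ j ∈ Finset.Ico n₀ n, layer j ω x i := by
    refine Finset.sum_congr rfl fun j hj => ?_
    obtain ⟨hj0, hjn⟩ := Finset.mem_Ico.1 hj
    rw [layer_apply_of_mem_gridCore ω (hS.1 p hpS j hj0),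
      layer_apply_of_mem_gridCore ω (hS.1 x hx j hj0), gridCell_eq_of_le hpc (by omega)]
  have hlast : layer n ω p i = (1 / 4) ^ n * labelVec v i := by
    rw [layer_apply_of_mem_gridCore ω (hS.1 p hpS n hn₀), hpv]; rfl
  have h1 := hv i
  have h2 := abs_lt.1 (hpg i)
  have hr : y i - partialMap g ω n₀ n x i - (1 / 4) ^ n * labelVec v i ∈
      Ico 0 ((1 / 4 : ℝ) ^ n) := by
    have e : y i - partialMap g ω n₀ n x i - (1 / 4) ^ n * labelVec v i =
        (1 / 4) ^ n * ((y i - partialMap g ω n₀ n x i) / (1 / 4) ^ n - labelVec v i) := by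
      field_simp
    rw [e]
    exact ⟨mul_nonneg ht.le h1.1, by nlinarith [h1.2]⟩
  have e2 : partialMap g ω n₀ (n + 1) p i =
      partialMap g ω n₀ n x i + (1 / 4) ^ n * labelVec v i + (g p i - g x i) := by
    unfold partialMap
    rw [Finset.sum_Ico_succ_top hn₀, hsum, hlast]; ring
  rw [e2, pow_succ]
  constructor <;> linarith [hr.1, hr.2]

/-- All targets reachable at level `k` from a point of the pruned set have fibers of large content;
the bound `C` depends on `k` and `s` but not on the target. -/
lemma exists_hasContentGE_fiber {S : Set (unitCube m)} {g : unitCube m → EuclideanSpace ℝ (Fin d)}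
    {n₀ n₁ : ℕ} {ω : ℕ × (Fin m → ℕ) → Label d} (hS : IsPruned S g n₀) (hn₁ : n₀ ≤ n₁)
    (hexp : ∀ n, n₀ ≤ n → 3 * d * n + 4 * d + 2 ≤ 3 * m * 4 ^ n) (hits : HasHits S g ω n₁)
    {f : C(unitCube m, EuclideanSpace ℝ (Fin d))}
    (hf : ∀ n, n₀ ≤ n → ∀ x i, |f x i - partialMap g ω n₀ n x i| ≤ 32 / 3 * (1 / 4) ^ n)
    {k : ℕ} (hk : n₁ ≤ k) {s : ℝ} (hs : 0 < s) (hsm : s < m) :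
    ∃ C : ℝ, 0 < C ∧ ∀ x ∈ S, ∀ y, IsReachable g ω n₀ k x y →
      HasContentGE s (ENNReal.ofReal C)⁻¹ (f ⁻¹' {y}) := by
  classical
  obtain ⟨C, hC, hcount⟩ := exists_card_le_mul_rpow (m := m) (d := d) (k := k)
    (fun n hn => hexp n (hn₁.trans (hk.trans hn))) hs hsm
  refine ⟨C, hC, fun x hx y hy => ?_⟩
  have htree := fun N => exists_finset_tree (c := gridCell (m := m)) gridCell_eq_of_succ_eq
    (Q := fun n x => x ∈ S ∧ IsReachable g ω n₀ n x y) (L := branching m d) (n₁ := n₁)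
    (fun n hn x hx => hits.exists_children hS hn₁ hn hx.1 hx.2) N k hk x ⟨hx, hy⟩
  choose P hP hPcard hPcell using htree
  have hpow : Tendsto (fun N : ℕ => (d : ℝ) * (56 / 3 * (1 / 4 : ℝ) ^ (k + N))) atTop (𝓝 0) := by
    have h := (tendsto_pow_atTop_nhds_zero_of_lt_one (r := (1 / 4 : ℝ)) (by norm_num)
      (by norm_num)).comp (tendsto_add_atTop_nat k)
    simpa [Function.comp_def, add_comm] using (h.const_mul (56 / 3)).const_mul (d : ℝ)
  have hgrid : Tendsto (fun N : ℕ => (gridSize (k + N) : ℝ)⁻¹) atTop (𝓝 0) := by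
    simpa [Function.comp_def, add_comm] using tendsto_inv_gridSize.comp (tendsto_add_atTop_nat k)
  refine hasContentGE_of_finsets f.continuous hs hpow hgrid P (fun N => ?_) (fun N p hp => ?_)
    fun N => hcount N (P N) (hPcard N) (hPcell N)
  · rw [← Finset.card_pos, hPcard]
    exact Finset.prod_pos fun j _ => by unfold branching; positivity
  · rw [dist_eq_norm]
    refine norm_le_of_abs_apply_le fun i => ?_
    have h1 := abs_le.1 (hf (k + N) (by omega) p i)
    have h2 := (hP N p hp).1.2 i
    rw [PiLp.sub_apply, abs_le]
    constructor <;> linarith [h1.1, h1.2, h2.1, h2.2]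

end Fibers

/-! ### A Borel set of good maps -/

section Good

variable {m d : ℕ}

/-- A sequence of exponents in `(0, m)` tending to `m`, for `m ≥ 1`. -/
noncomputable def exponentSeq (m j : ℕ) : ℝ≥0 := m - 1 / (j + 2)

lemma coe_exponentSeq (hm : 0 < m) (j : ℕ) : (exponentSeq m j : ℝ) = m - 1 / (j + 2) := by
  have h1 : (1 : ℝ≥0) ≤ m := by exact_mod_cast hm
  have h2 : 1 / ((j : ℝ≥0) + 2) ≤ m := by
    refine le_trans ?_ h1
    rw [div_le_one (by positivity)]
    exact le_add_left one_le_two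
  rw [exponentSeq, NNReal.coe_sub h2]
  push_cast
  rfl

lemma exponentSeq_pos (hm : 0 < m) (j : ℕ) : 0 < exponentSeq m j := by
  rw [← NNReal.coe_pos, coe_exponentSeq hm, sub_pos, div_lt_iff₀ (by positivity)]
  have h1 : (1 : ℝ) ≤ m := by exact_mod_cast hm
  have h2 : (0 : ℝ) ≤ j := by positivity
  nlinarith

lemma exponentSeq_lt (hm : 0 < m) (j : ℕ) : (exponentSeq m j : ℝ) < m := by
  rw [coe_exponentSeq hm]
  have : (0 : ℝ) < 1 / (j + 2) := by positivity
  linarith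

lemma dimH_eq_of_forall_exponentSeq_le (hm : 0 < m) {F : Set (unitCube m)}
    (h : ∀ j, (exponentSeq m j : ℝ≥0∞) ≤ dimH F) : dimH F = m := by
  refine le_antisymm ?_ ?_
  · rw [← isometry_subtype_coe.dimH_image]
    refine (dimH_mono (subset_univ _)).trans ?_
    rw [Real.dimH_univ_eq_finrank]
    simp
  · have hlim : Tendsto (fun j => (exponentSeq m j : ℝ≥0∞)) atTop (𝓝 ((m : ℝ≥0) : ℝ≥0∞)) := by
      refine ENNReal.tendsto_coe.2 (NNReal.tendsto_coe.1 ?_)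
      simp only [coe_exponentSeq hm]
      have : Tendsto (fun j : ℕ => (1 : ℝ) / (j + 2)) atTop (𝓝 0) := by
        have h := (tendsto_one_div_add_atTop_nhds_zero_nat (𝕜 := ℝ)).comp (tendsto_add_atTop_nat 1)
        refine h.congr fun j => ?_
        simp only [Function.comp_apply]
        push_cast
        ring
      simpa using tendsto_const_nhds.sub this
    exact_mod_cast le_of_tendsto' hlim h

/-- All fibers of `f` over `V` have Hausdorff content bounded below, in each dimension `s < m`. -/
def HasBigFibers (f : C(unitCube m, EuclideanSpace ℝ (Fin d)))
    (V : Set (EuclideanSpace ℝ (Fin d))) : Prop :=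
  ∀ j, ∃ c : ℕ, ∀ y ∈ V, HasContentGE (exponentSeq m j : ℝ) ((c : ℝ≥0∞) + 1)⁻¹ (f ⁻¹' {y})

/-- The union of the basic open sets over which `f` has big fibers. -/
def bigFiberTargets (f : C(unitCube m, EuclideanSpace ℝ (Fin d))) :
    Set (EuclideanSpace ℝ (Fin d)) :=
  ⋃ V ∈ TopologicalSpace.countableBasis (EuclideanSpace ℝ (Fin d)), {y ∈ V | HasBigFibers f V}

lemma isOpen_bigFiberTargets (f : C(unitCube m, EuclideanSpace ℝ (Fin d))) :
    IsOpen (bigFiberTargets f) := by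
  refine isOpen_biUnion fun V hV => ?_
  by_cases h : HasBigFibers f V
  · simpa [h] using TopologicalSpace.isOpen_of_mem_countableBasis hV
  · simp [h]

lemma dimH_fiber_of_mem_bigFiberTargets (hm : 0 < m)
    {f : C(unitCube m, EuclideanSpace ℝ (Fin d))} {y : EuclideanSpace ℝ (Fin d)}
    (hy : y ∈ bigFiberTargets f) : dimH (f ⁻¹' {y}) = m := by
  obtain ⟨V, -, hyV, hV⟩ := mem_iUnion₂.1 hy
  refine dimH_eq_of_forall_exponentSeq_le hm fun j => ?_
  obtain ⟨c, hc⟩ := hV j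
  exact (hc y hyV).le_dimH (exponentSeq_pos hm j) (by simp)

lemma measurableSet_hasBigFibers [MeasurableSpace C(unitCube m, EuclideanSpace ℝ (Fin d))]
    [BorelSpace C(unitCube m, EuclideanSpace ℝ (Fin d))] (V : Set (EuclideanSpace ℝ (Fin d))) :
    MeasurableSet {f : C(unitCube m, EuclideanSpace ℝ (Fin d)) | HasBigFibers f V} := by
  have : {f : C(unitCube m, EuclideanSpace ℝ (Fin d)) | HasBigFibers f V} =
      ⋂ j, ⋃ c : ℕ, {f : C(unitCube m, EuclideanSpace ℝ (Fin d)) |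
        ∀ y ∈ V, HasContentGE (exponentSeq m j : ℝ) ((c : ℝ≥0∞) + 1)⁻¹ (f ⁻¹' {y})} := by
    ext f
    simp [HasBigFibers]
  rw [this]
  exact MeasurableSet.iInter fun j => MeasurableSet.iUnion fun c =>
    (isClosed_setOf_hasContentGE _ _ V).measurableSet

/-- The maps that send almost every point to a target with big fibers. -/
def goodMaps (m d : ℕ) : Set C(unitCube m, EuclideanSpace ℝ (Fin d)) :=
  {f | volume {x | f x ∉ bigFiberTargets f} = 0}

lemma measurableSet_goodMaps [MeasurableSpace C(unitCube m, EuclideanSpace ℝ (Fin d))]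
    [BorelSpace C(unitCube m, EuclideanSpace ℝ (Fin d))] : MeasurableSet (goodMaps m d) := by
  have hR : MeasurableSet {p : C(unitCube m, EuclideanSpace ℝ (Fin d)) × unitCube m |
      p.1 p.2 ∉ bigFiberTargets p.1} := by
    have : {p : C(unitCube m, EuclideanSpace ℝ (Fin d)) × unitCube m |
        p.1 p.2 ∉ bigFiberTargets p.1} =
        (⋃ V ∈ TopologicalSpace.countableBasis (EuclideanSpace ℝ (Fin d)),
          {p : C(unitCube m, EuclideanSpace ℝ (Fin d)) × unitCube m | p.1 p.2 ∈ V} ∩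
            Prod.fst ⁻¹' {f | HasBigFibers f V})ᶜ := by
      ext p
      simp only [bigFiberTargets, mem_ofPred_eq, mem_compl_iff, mem_iUnion, mem_inter_iff,
        mem_preimage, exists_prop]
    rw [this]
    refine (MeasurableSet.biUnion (TopologicalSpace.countable_countableBasis _)
      fun V hV => ?_).compl
    refine MeasurableSet.inter ?_ (measurable_fst (measurableSet_hasBigFibers V))
    have hc : Continuous
        fun p : C(unitCube m, EuclideanSpace ℝ (Fin d)) × unitCube m => p.1 p.2 := by
      fun_prop
    exact (TopologicalSpace.isOpen_of_mem_countableBasis hV).measurableSet.preimage hc.measurable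
  exact (measurable_measure_prodMk_left (ν := (volume : Measure (unitCube m))) hR)
    (measurableSet_singleton 0)

lemma volume_pos_of_isOpen {O : Set (unitCube m)} (hO : IsOpen O) {x : unitCube m} (hx : x ∈ O) :
    0 < volume O := by
  obtain ⟨r, hr, hrO⟩ := Metric.isOpen_iff.1 hO x hx
  let ε : ℝ := r / (m + 1)
  have hε : 0 < ε := by positivity
  have hsub : {z : unitCube m | ∀ i, z.1 i ∈
      Icc (max 0 (x.1 i - ε)) (min 1 (x.1 i + ε))} ⊆ O := by
    intro z hz
    refine hrO (Metric.mem_ball.2 ?_)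
    rw [Subtype.dist_eq, dist_eq_norm]
    refine (norm_le_of_abs_apply_le (c := ε) fun i => ?_).trans_lt ?_
    · have h1 := hz i
      rw [mem_Icc, max_le_iff, le_min_iff] at h1
      rw [PiLp.sub_apply, abs_le]
      constructor <;> linarith [h1.1.2, h1.2.2]
    · have : (m : ℝ) * ε + ε = r := by simp only [ε]; field_simp
      linarith
  refine lt_of_lt_of_le ?_ (measure_mono hsub)
  rw [volume_setOf_coord_mem_Icc, inter_eq_left.2, Real.volume_Icc_pi]
  · refine pos_iff_ne_zero.2 (Finset.prod_ne_zero_iff.2 fun i _ => ne_of_gt ?_)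
    rw [ENNReal.ofReal_pos, sub_pos, max_lt_iff, lt_min_iff, lt_min_iff]
    have := x.2 i
    exact ⟨⟨one_pos, by linarith [this.1]⟩, by linarith [this.2], by linarith⟩
  · exact Icc_subset_Icc (fun i => le_max_left _ _) (fun i => min_le_left _ _)

lemma range_subset_closure_of_mem_goodMaps {f : C(unitCube m, EuclideanSpace ℝ (Fin d))}
    (hf : f ∈ goodMaps m d) : range f ⊆ closure (bigFiberTargets f ∩ range f) := by
  rintro _ ⟨x, rfl⟩
  refine mem_closure_iff.2 fun W hW hxW => ?_
  have hpos := volume_pos_of_isOpen (hW.preimage f.continuous) hxW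
  by_contra hc
  rw [not_nonempty_iff_eq_empty] at hc
  refine hpos.ne' (measure_mono_null (fun z hz => ?_) hf)
  intro hzU
  exact (eq_empty_iff_forall_notMem.1 hc (f z)) ⟨hz, hzU, z, rfl⟩

lemma volume_image_preimage_of_mem_goodMaps {f : C(unitCube m, EuclideanSpace ℝ (Fin d))}
    (hf : f ∈ goodMaps m d) :
    volume ((↑) '' (f ⁻¹' bigFiberTargets f) : Set (EuclideanSpace ℝ (Fin m))) = 1 := by
  rw [← comap_subtype_coe_apply (measurableSet_unitCube m)]
  change (volume : Measure (unitCube m)) (f ⁻¹' bigFiberTargets f) = 1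
  rw [← prob_compl_eq_zero_iff]
  · exact hf
  · exact ((isOpen_bigFiberTargets f).preimage f.continuous).measurableSet

/-! ### Almost sure goodness of random perturbations -/

lemma ae_ae_frequently_label_eq (v : Label d) :
    ∀ᵐ ω ∂labelsMeasure m d, ∀ᵐ x : unitCube m, ∀ n₀ : ℕ, ∃ n, n₀ ≤ n ∧
      ω (n, gridCell (n + 1) x) = v := by
  have hmeas : MeasurableSet {p : (ℕ × (Fin m → ℕ) → Label d) × unitCube m |
      ∀ n₀ : ℕ, ∃ n, n₀ ≤ n ∧ p.1 (n, gridCell (n + 1) p.2) = v} := by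
    have h1 : ∀ n, MeasurableSet {p : (ℕ × (Fin m → ℕ) → Label d) × unitCube m |
        p.1 (n, gridCell (n + 1) p.2) = v} := by
      intro n
      have : {p : (ℕ × (Fin m → ℕ) → Label d) × unitCube m | p.1 (n, gridCell (n + 1) p.2) = v} =
          ⋃ J : Fin m → ℕ, {ω | ω (n, J) = v} ×ˢ (gridCell (n + 1) ⁻¹' {J}) := by
        ext p
        simp
      rw [this]
      refine MeasurableSet.iUnion fun J => MeasurableSet.prod ?_
        (measurable_gridCell _ (measurableSet_singleton J))
      exact (measurable_pi_apply (n, J) : Measurable fun ω : ℕ × (Fin m → ℕ) → Label d => ω (n, J))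
        (measurableSet_singleton v)
    have h2 : {p : (ℕ × (Fin m → ℕ) → Label d) × unitCube m |
        ∀ n₀ : ℕ, ∃ n, n₀ ≤ n ∧ p.1 (n, gridCell (n + 1) p.2) = v} =
        ⋂ n₀ : ℕ, ⋃ n, ⋃ (_ : n₀ ≤ n), {p : (ℕ × (Fin m → ℕ) → Label d) × unitCube m |
          p.1 (n, gridCell (n + 1) p.2) = v} := by
      ext p
      simp
    rw [h2]
    exact MeasurableSet.iInter fun n₀ => MeasurableSet.iUnion fun n => MeasurableSet.iUnion fun _ =>
      h1 n
  rw [Measure.ae_ae_comm hmeas]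
  refine Eventually.of_forall fun x => ?_
  exact ae_frequently_label_eq (p := (1 / 16) ^ d) (by positivity) (labelMeasure_singleton v)
    (e := fun n => (n, gridCell (n + 1) x)) fun a b h => (Prod.ext_iff.1 h).1

/-- At a point of the pruned set whose labels are infinitely often the label of the zero vector, the
value of the perturbed map is an interior point of the set of reachable targets. -/
lemma mem_bigFiberTargets_of_hasHits (hm : 0 < m) {S : Set (unitCube m)}
    {g : unitCube m → EuclideanSpace ℝ (Fin d)}
    {n₀ n₁ : ℕ} {ω : ℕ × (Fin m → ℕ) → Label d} (hS : IsPruned S g n₀) (hn₁ : n₀ ≤ n₁)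
    (hexp : ∀ n, n₀ ≤ n → 3 * d * n + 4 * d + 2 ≤ 3 * m * 4 ^ n) (hits : HasHits S g ω n₁)
    {f : C(unitCube m, EuclideanSpace ℝ (Fin d))}
    (hf : ∀ n, n₀ ≤ n → ∀ x i, |f x i - partialMap g ω n₀ n x i| ≤ 32 / 3 * (1 / 4) ^ n)
    {x : unitCube m} (hx : x ∈ S)
    (hzero : ∀ n, ∃ k, n ≤ k ∧ ω (k, gridCell (k + 1) x) = fun _ => 8) :
    f x ∈ bigFiberTargets f := by
  obtain ⟨k, hk, hωk⟩ := hzero n₁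
  have ht : (0 : ℝ) < (1 / 4) ^ k := by positivity
  have hk₀ : n₀ ≤ k := hn₁.trans hk
  have hclose : ∀ i, |f x i - partialMap g ω n₀ k x i| ≤ 8 / 3 * (1 / 4) ^ k := by
    intro i
    have h := hf (k + 1) (by omega) x i
    have e : partialMap g ω n₀ (k + 1) x i = partialMap g ω n₀ k x i := by
      unfold partialMap
      rw [Finset.sum_Ico_succ_top hk₀, layer_apply_of_mem_gridCore ω (hS.1 x hx k hk₀), hωk,
        labelVec_const_eight]
      simp
    rw [e, pow_succ] at h
    linarith
  obtain ⟨V, hV, hxV, hVsub⟩ :=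
    (TopologicalSpace.isBasis_countableBasis (EuclideanSpace ℝ (Fin d))).exists_subset_of_mem_open
      (Metric.mem_ball_self ht (x := f x)) Metric.isOpen_ball
  refine mem_iUnion₂.2 ⟨V, hV, hxV, fun j => ?_⟩
  obtain ⟨C, hC, h⟩ := exists_hasContentGE_fiber hS hn₁ hexp hits hf hk
    (NNReal.coe_pos.2 (exponentSeq_pos hm j)) (exponentSeq_lt hm j)
  refine ⟨⌈C⌉₊, fun y hy U hU hcov => le_trans ?_ (h x hx y (fun i => ?_) U hU hcov)⟩
  · refine ENNReal.inv_le_inv.2 ?_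
    calc ENNReal.ofReal C ≤ ENNReal.ofReal ⌈C⌉₊ := ENNReal.ofReal_le_ofReal (Nat.le_ceil C)
      _ = (⌈C⌉₊ : ℝ≥0∞) := ENNReal.ofReal_natCast _
      _ ≤ _ := le_self_add
  · have h1 : |y i - f x i| < (1 / 4) ^ k := by
      have h2 : dist y (f x) < (1 / 4) ^ k := hVsub hy
      rw [dist_eq_norm] at h2
      refine lt_of_le_of_lt ?_ h2
      simpa using PiLp.norm_apply_le (y - f x) i
    have h1 := abs_lt.1 h1
    have h2 := abs_le.1 (hclose i)
    constructor <;> linarith [h1.1, h1.2, h2.1, h2.2]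

/-- The pruned set lies only in the cores of levels above `n₀`, so the first `n₀` layers need not be
constant on the part of this set in a single cell; they are therefore added to `g` before pruning.
Their sum takes only countably many values as the labels vary, hence almost surely the conclusion
about hits holds for all of these values simultaneously. -/
lemma ae_add_randomMap_mem_goodMaps (hm : 0 < m) (hd : 0 < d)
    (g : C(unitCube m, EuclideanSpace ℝ (Fin d))) :
    ∀ᵐ ω ∂labelsMeasure m d, g + randomMap ω ∈ goodMaps m d := by
  let ψ : ℕ → (ℕ × (Fin m → ℕ) → Label d) → C(unitCube m, EuclideanSpace ℝ (Fin d)) :=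
    fun n ω => ∑ j ∈ Finset.range n, layer j ω
  have hψ : ∀ n ω x i, ψ n ω x i = ∑ j ∈ Finset.range n, layer j ω x i := by
    intro n ω x i
    simp [ψ, ContinuousMap.sum_apply]
  let C : ℕ := ⌈‖g‖ + 64 / 3⌉₊
  have hC : ∀ n ω x i, |(g + ψ n ω) x i| ≤ C := by
    intro n ω x i
    have h1 : |g x i| ≤ ‖g‖ := by
      refine le_trans ?_ (ContinuousMap.norm_coe_le_norm g x)
      simpa using PiLp.norm_apply_le (g x) i
    have h2 := abs_le.1 (abs_randomMap_sub_le n ω x i)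
    have h3 := abs_le.1 (abs_randomMap_sub_le 0 ω x i)
    have h4 : (1 / 4 : ℝ) ^ n ≤ 1 := pow_le_one₀ (by norm_num) (by norm_num)
    simp only [Finset.range_zero, Finset.sum_empty, sub_zero, pow_zero, mul_one] at h3
    have h1 := abs_le.1 h1
    refine le_trans ?_ (Nat.le_ceil _)
    rw [ContinuousMap.add_apply, PiLp.add_apply, hψ, abs_le]
    constructor <;> linarith [h1.1, h1.2, h2.1, h2.2, h3.1, h3.2]
  obtain ⟨N, hN⟩ := eventually_atTop.1 (eventually_exponent_le hm d)
  have hmain : ∀ᵐ ω ∂labelsMeasure m d, ∀ n₀, N ≤ n₀ → ∀ h ∈ range (ψ n₀),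
      ∃ (S : Set (unitCube m)) (n₁ : ℕ), IsPruned S (g + h) n₀ ∧
        volume Sᶜ ≤ ∑' k, ENNReal.ofReal (lossBound m d C (k + n₀)) ∧ n₀ ≤ n₁ ∧
        HasHits S (g + h) ω n₁ := by
    rw [ae_all_iff]
    intro n₀
    rw [eventually_imp_distrib_left]
    intro hn₀
    rw [ae_ball_iff (countable_range_sum_layer n₀)]
    rintro _ ⟨ω', rfl⟩
    obtain ⟨S, -, hS, hvol⟩ := exists_isPruned (g := (g + ψ n₀ ω'))
      (ContinuousMap.continuous _).measurable (hC n₀ ω') n₀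
    filter_upwards [hS.ae_exists_hasHits hm (hC n₀ ω') (hN n₀ hn₀)] with ω hω
    obtain ⟨n₁, hn₁, hits⟩ := hω
    exact ⟨S, n₁, hS, hvol, hn₁, hits⟩
  filter_upwards [hmain, ae_ae_frequently_label_eq (m := m) (fun _ => 8 : Label d)] with ω hω hzero
  have hle : ∀ n₀, N ≤ n₀ → volume {x | (g + randomMap ω) x ∉ bigFiberTargets (g + randomMap ω)} ≤
      ∑' k, ENNReal.ofReal (lossBound m d C (k + n₀)) := by
    intro n₀ hn₀
    obtain ⟨S, n₁, hS, hvol, hn₁, hits⟩ := hω n₀ hn₀ _ ⟨ω, rfl⟩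
    have hf : ∀ n, n₀ ≤ n → ∀ x i,
        |(g + randomMap ω) x i - partialMap (g + ψ n₀ ω) ω n₀ n x i| ≤ 32 / 3 * (1 / 4) ^ n := by
      intro n hn x i
      have e : (g + randomMap ω) x i - partialMap (g + ψ n₀ ω) ω n₀ n x i =
          randomMap ω x i - ∑ j ∈ Finset.range n, layer j ω x i := by
        unfold partialMap
        rw [← Finset.sum_range_add_sum_Ico _ hn, ← hψ]
        simp only [ContinuousMap.add_apply, PiLp.add_apply]
        ring
      rw [e]
      exact abs_randomMap_sub_le n ω x i
    refine le_trans ?_ hvol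
    refine measure_mono_ae ?_
    filter_upwards [hzero] with x hx
    intro hbad hxS
    exact hbad (mem_bigFiberTargets_of_hasHits hm hS hn₁ (hN n₀ hn₀) hits hf hxS hx)
  have hlim := ENNReal.tendsto_sum_nat_add (fun k => ENNReal.ofReal (lossBound m d C k))
    (summable_lossBound hd m C).tsum_ofReal_ne_top
  refine le_antisymm (ge_of_tendsto hlim ?_) bot_le
  filter_upwards [eventually_ge_atTop N] with n₀ hn₀
  exact hle n₀ hn₀

end Good

theorem corollaryc (m d : ℕ) (hm : 0 < m) (hd : 0 < d)
    [MeasurableSpace C(unitCube m, EuclideanSpace ℝ (Fin d))]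
    [BorelSpace C(unitCube m, EuclideanSpace ℝ (Fin d))] :
    IsPrevalent {f : C(unitCube m, EuclideanSpace ℝ (Fin d)) |
      ∃ U : Set (EuclideanSpace ℝ (Fin d)), IsOpen U ∧
        volume ((↑) '' (f ⁻¹' U) : Set (EuclideanSpace ℝ (Fin m))) = 1 ∧
        Set.range f ⊆ closure (U ∩ Set.range f) ∧
        ∀ y ∈ U, dimH (f ⁻¹' {y}) = (m : ENNReal)} := by
  have hΦ := measurable_randomMap (m := m) (d := d)
  refine ⟨(goodMaps m d)ᶜ, (labelsMeasure m d).map randomMap, measurableSet_goodMaps.compl,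
    Measure.isProbabilityMeasure_map hΦ.aemeasurable, compl_subset_compl.2 fun f hf => ?_,
    fun g => ?_⟩
  · exact ⟨bigFiberTargets f, isOpen_bigFiberTargets f, volume_image_preimage_of_mem_goodMaps hf,
      range_subset_closure_of_mem_goodMaps hf, fun y hy => dimH_fiber_of_mem_bigFiberTargets hm hy⟩
  · rw [image_add_right, Measure.map_apply hΦ
      ((measurable_add_const (-g)) measurableSet_goodMaps.compl)]
    have h := ae_add_randomMap_mem_goodMaps hm hd (-g)
    rw [ae_iff] at h
    refine measure_mono_null (fun ω hω => ?_) h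
    rw [mem_ofPred_eq, add_comm]
    exact hω
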